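/- For $f:\mathbb R^2\to\mathbb R$ and $a<b$, $c<d$ put $\Delta f([a,b]\times[c,d])=f(b,d)-f(a,d)-f(b,c)+f(a,c)$. The function $f$ has bounded variation in the sense of Vitali if $\sup\sum_{i,j}|\Delta f([x_{i-1},x_i]\times[y_{j-1},y_j])|<\infty$, the supremum being over all grid partitions $x_0<\dots<x_n$, $y_0<\dots<y_m$ of all compact rectangles in $\mathbb R^2$. Let $BV_{\|0\|}(\mathbb R^2)$ be the set of functions $f:\mathbb R^2\to\mathbb R$ of bounded variation in the sense of Vitali such that $f(x,y)\to0$ as $\|(x,y)\|\to\infty$. The KP-Fourier transform of $f$ at $(\xi,\eta)$ is $$\mathcal F(f)(\xi,\eta)=\lim_{\substack{a,c\to-\infty\\ b,d\to\infty}}\iint_{[a,b]\times[c,d]}f(t_1,t_2)\,e^{-i(\xi t_1+\eta t_2)}\,d(t_1,t_2),$$ where the integrals are Kurzweil–Henstock integrals over compact rectangles (required to exist on every compact rectangle) and the limit is taken in the sense of Pringsheim ($a,b,c,d$ tend to their limits independently). **Theorem (Dirichlet–Jordan theorem for the KP-Fourier transform).** Let $f\in BV_{\|0\|}(\mathbb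 R^2)$ and $(x,y)\in\mathbb R^2$. Then $\mathcal F(f)(\xi,\eta)$ exists for all $\xi\ne0$, $\eta\ne0$; for all $0<\alpha_i<\beta_i<\infty$ $(i=1,2)$ the function $\mathcal F(f)(\xi,\eta)e^{i(x\xi+y\eta)}$ is Lebesgue integrable over $$R_{\alpha_1,\alpha_2}^{\beta_1,\beta_2}=\{(\xi,\eta)\in\mathbb R^2:\alpha_1\le|\xi|\le\beta_1,\ \alpha_2\le|\eta|\le\beta_2\};$$ the four quadrant limits $f(x\pm,y\pm)=\lim f(s,t)$, as $s\to x^{\pm}$ and $t\to y^{\pm}$ jointly (the two signs chosen independently), exist; and $$\lim_{\substack{\alpha_1,\alpha_2\to0^+\\ \beta_1,\beta_2\to\infty}}\frac1{4\pi^2}\iint_{R_{\alpha_1,\alpha_2}^{\beta_1,\beta_2}}\mathcal F(f)(\xi,\eta)\,e^{i(x\xi+y\eta)}\,d(\xi,\eta)=\frac{f(x+,y+)+f(x+,y-)+f(x-,y+)+f(x-,y-)}4,$$ where $\alpha_1,\alpha_2,\beta_1,\beta_2$ tend to their limits independently. -/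

import Mathlib

open Filter Topology MeasureTheory
open scoped ENNReal

noncomputable section

namespace KPFourier

/-- The mixed second difference of `f` over the rectangle `[a, b] × [c, d]`. -/
def mixedDiff (f : ℝ × ℝ → ℝ) (a b c d : ℝ) : ℝ :=
  f (b, d) - f (a, d) - f (b, c) + f (a, c)

/-- The Vitali variation of `f` over the plane: the supremum, over all compact rectangles
`[s 0, s n] × [t 0, t m]` and all their grid partitions, of the sum of the absolute values of the
mixed differences over the cells. (As in Mathlib's `eVariationOn`, repeated partition points are
allowed; the corresponding degenerate cells contribute `0`.) -/
def vitaliVariation (f : ℝ × ℝ → ℝ) : ℝ≥0∞ :=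
  ⨆ (n : ℕ) (m : ℕ) (s : {u : ℕ → ℝ // Monotone u}) (t : {u : ℕ → ℝ // Monotone u}),
    ∑ i ∈ Finset.range n, ∑ j ∈ Finset.range m,
      ENNReal.ofReal |mixedDiff f (s.1 i) (s.1 (i + 1)) (t.1 j) (t.1 (j + 1))|

/-- Functions of bounded Vitali variation on the plane that vanish at infinity. -/
structure MemBVVanishing (f : ℝ × ℝ → ℝ) : Prop where
  boundedVariation : vitaliVariation f < ∞
  vanishing : Tendsto f (comap (fun p : ℝ × ℝ => ‖p‖) atTop) (𝓝 0)

/-- The nondegenerate rectangle `[a, b] × [c, d]` as a box in `ℝ²`. (The integral below only sees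
the closed box: tags range over closed cells.) -/
def rectBox (a b c d : ℝ) (hab : a < b) (hcd : c < d) : BoxIntegral.Box (Fin 2) where
  lower := ![a, c]
  upper := ![b, d]
  lower_lt_upper := by
    intro i
    fin_cases i
    · simpa using hab
    · simpa using hcd

/-- Kurzweil–Henstock integrability over every compact rectangle: the gauge integral with
tagged partitions into rectangles, each tag lying in its closed cell. -/
def KHLocIntegrable (F : ℝ × ℝ → ℂ) : Prop :=
  ∀ (a b c d : ℝ) (hab : a < b) (hcd : c < d),
    BoxIntegral.Integrable (rectBox a b c d hab hcd) BoxIntegral.IntegrationParams.Henstock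
      (fun t : Fin 2 → ℝ => F (t 0, t 1)) BoxIntegral.BoxAdditiveMap.volume

open Classical in
/-- The Kurzweil–Henstock integral of `F` over `[a, b] × [c, d]`, for `a < b` and `c < d`. -/
def khIntegral (F : ℝ × ℝ → ℂ) (a b c d : ℝ) : ℂ :=
  if h : a < b ∧ c < d then
    BoxIntegral.integral (rectBox a b c d h.1 h.2) BoxIntegral.IntegrationParams.Henstock
      (fun t : Fin 2 → ℝ => F (t 0, t 1)) BoxIntegral.BoxAdditiveMap.volume
  else 0

/-- The integrand `f(t₁, t₂) e^{-i(ξ t₁ + η t₂)}`. -/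
def fourierIntegrand (f : ℝ × ℝ → ℝ) (ξ η : ℝ) (t : ℝ × ℝ) : ℂ :=
  (f t : ℂ) * Complex.exp (-(Complex.I * ((ξ * t.1 + η * t.2 : ℝ) : ℂ)))

/-- The filter on quadruples `(a, b, c, d)` of the Pringsheim limit in which
`a, c → -∞` and `b, d → ∞` independently. -/
def pringsheim : Filter (ℝ × ℝ × ℝ × ℝ) := atBot ×ˢ atTop ×ˢ atBot ×ˢ atTop

/-- The truncated Fourier integrals of `f` at `(ξ, η)`, as a function of `(a, b, c, d)`. -/
def truncatedFourier (f : ℝ × ℝ → ℝ) (ξ η : ℝ) (r : ℝ × ℝ × ℝ × ℝ) : ℂ :=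
  khIntegral (fourierIntegrand f ξ η) r.1 r.2.1 r.2.2.1 r.2.2.2

/-- The KP-Fourier transform of `f` at `(ξ, η)` exists and equals `L`. -/
def HasKPFourierAt (f : ℝ × ℝ → ℝ) (ξ η : ℝ) (L : ℂ) : Prop :=
  KHLocIntegrable (fourierIntegrand f ξ η) ∧
    Tendsto (truncatedFourier f ξ η) pringsheim (𝓝 L)

/-- The KP-Fourier transform of `f` at `(ξ, η)` (meaningful where it exists, in the sense of
`HasKPFourierAt`). -/
def kpFourier (f : ℝ × ℝ → ℝ) (ξ η : ℝ) : ℂ :=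
  limUnder pringsheim (truncatedFourier f ξ η)

/-- The set of `(ξ, η)` with `α₁ ≤ |ξ| ≤ β₁` and `α₂ ≤ |η| ≤ β₂`. -/
def frequencyRegion (α₁ α₂ β₁ β₂ : ℝ) : Set (ℝ × ℝ) :=
  {p | (α₁ ≤ |p.1| ∧ |p.1| ≤ β₁) ∧ (α₂ ≤ |p.2| ∧ |p.2| ≤ β₂)}

/-- The integrand `𝓕(f)(ξ, η) e^{i(xξ + yη)}` of the inversion integral. -/
def inversionIntegrand (f : ℝ × ℝ → ℝ) (x y : ℝ) (p : ℝ × ℝ) : ℂ :=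
  kpFourier f p.1 p.2 * Complex.exp (Complex.I * ((x * p.1 + y * p.2 : ℝ) : ℂ))

end KPFourier

end

open KPFourier

namespace KPFourier

/-! ### Grid measures -/

/-! A function of bounded Vitali variation that vanishes at infinity is, up to its values on lines
carrying mass, the distribution function of a signed measure `μ - ν` with `μ`, `ν` finite and
positive. These are weak limits of discrete measures that put the positive and negative parts of the
cell differences at grid points; tightness holds because one fixed grid already captures nearly all
of the variation. What survives in the limit is the sandwich in `MemBVVanishing.exists_measures`:
`f` lies between the versions with open and with closed quadrants. This yields the quadrant limits
by continuity of measures and makes `f` measurable up to a null set.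

Vanishing at infinity also forces `μ` and `ν` to have the same marginals. Hence constants may be
added to either factor of a product integrand `g(u)h(v)` without changing its integral against `μ -
ν`. This is used twice.

In the transform, Fubini over a rectangle produces differences of exponentials; the terms at the
upper ends are constants and drop out, and dominated convergence shows that `(iξ)(iη)𝓕(f)(ξ,η)` is
the Fourier transform of `μ - ν` (`Represents.hasKPFourierAt`). In the inversion, Fubini leaves a
product of factors `2(Si(wβ) - Si(wα))`, with `w = x - u` and `w = y - v`, which converge boundedly
to `π sign w`. Each sign is the indicator of `(-∞, x)` plus that of `(-∞, x]` minus 1; the constant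
drops out again, and the product of the indicator sums gives the four quadrant limits with total
factor `π² / (4π²)`. -/

theorem exists_monotone_enumeration (A : Finset ℝ) :
    ∃ (s : ℕ → ℝ) (n : ℕ), Monotone s ∧ ∀ a ∈ A, ∃ i ≤ n, s i = a := by
  rcases A.eq_empty_or_nonempty with rfl | hA
  · exact ⟨fun _ => 0, 0, monotone_const, by simp⟩
  have hc : 0 < A.card := hA.card_pos
  -- The sequence stays at the largest element once the set is exhausted, so it is monotone on all
  -- of `ℕ`.
  refine ⟨fun i => A.orderEmbOfFin rfl ⟨min i (A.card - 1), by omega⟩, A.card - 1, ?_, ?_⟩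
  · intro i j hij
    apply (A.orderEmbOfFin rfl).monotone
    simp only [Fin.mk_le_mk]
    omega
  · intro a ha
    have : a ∈ Set.range (A.orderEmbOfFin rfl) := by simpa using ha
    obtain ⟨⟨k, hk⟩, rfl⟩ := this
    exact ⟨k, by omega, congrArg (A.orderEmbOfFin rfl) (Fin.ext (min_eq_left (by omega)))⟩

/-- The indicator function of `(-∞, p]`. -/
noncomputable def iicInd (p u : ℝ) : ℝ := if u ≤ p then 1 else 0

theorem iicInd_mono (u : ℝ) : Monotone fun p => iicInd p u := by
  intro p q hpq
  simp only [iicInd]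
  split_ifs <;> linarith

/-- The weight, read at the right end of each cell, stops the telescoping sum at `s i₀`. A later
cell with nonzero weight is degenerate, since repeated points are allowed, and contributes 0. -/
theorem sum_iicInd_mul_sub {s : ℕ → ℝ} (hs : Monotone s) {n i₀ : ℕ} (hi : i₀ ≤ n) (g : ℝ → ℝ) :
    ∑ i ∈ Finset.range n, iicInd (s i₀) (s (i + 1)) * (g (s (i + 1)) - g (s i))
      = g (s i₀) - g (s 0) := by
  rw [← Finset.sum_range_sub (fun i => g (s i)) i₀]
  symm
  apply Finset.sum_subset_zero_on_sdiff (Finset.range_mono hi)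
  · intro i h
    simp only [Finset.mem_sdiff, Finset.mem_range, not_lt] at h
    by_cases h' : s (i + 1) ≤ s i₀
    · have h1 := hs h.2
      have h2 := hs (Nat.le_succ i)
      have : s (i + 1) = s i := le_antisymm (h'.trans h1) h2
      simp [this]
    · simp [iicInd, h']
  · intro i h
    have : s (i + 1) ≤ s i₀ := hs (Finset.mem_range.1 h)
    simp [iicInd, this]

/-- A mixed difference is a difference in each variable separately, so weights that telescope in one
dimension can be multiplied. -/
theorem sum_mul_mixedDiff (f : ℝ × ℝ → ℝ) {s t : ℕ → ℝ} {n m : ℕ} {w z : ℝ → ℝ} {a b c d : ℝ}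
    (hw : ∀ g : ℝ → ℝ, ∑ i ∈ Finset.range n, w (s (i + 1)) * (g (s (i + 1)) - g (s i)) = g b - g a)
    (hz : ∀ g : ℝ → ℝ, ∑ j ∈ Finset.range m, z (t (j + 1)) * (g (t (j + 1)) - g (t j)) = g d - g c) :
    ∑ i ∈ Finset.range n, ∑ j ∈ Finset.range m,
      w (s (i + 1)) * z (t (j + 1)) * mixedDiff f (s i) (s (i + 1)) (t j) (t (j + 1))
      = mixedDiff f a b c d := by
  have h1 : ∀ i, ∑ j ∈ Finset.range m,
      w (s (i + 1)) * z (t (j + 1)) * mixedDiff f (s i) (s (i + 1)) (t j) (t (j + 1))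
      = w (s (i + 1)) * ((f (s (i + 1), d) - f (s (i + 1), c)) - (f (s i, d) - f (s i, c))) := by
    intro i
    have := hz (fun v => f (s (i + 1), v) - f (s i, v))
    rw [show (f (s (i + 1), d) - f (s (i + 1), c)) - (f (s i, d) - f (s i, c))
      = f (s (i + 1), d) - f (s i, d) - (f (s (i + 1), c) - f (s i, c)) by ring, ← this,
      Finset.mul_sum]
    refine Finset.sum_congr rfl fun j _ => ?_
    simp only [mixedDiff]
    ring
  simp only [h1]
  rw [hw (fun u => f (u, d) - f (u, c))]
  simp only [mixedDiff]
  ring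

/-- The sum of the point masses `D i j` (if positive) at the upper right corners of the cells. -/
noncomputable def gridMeasure (D : ℕ → ℕ → ℝ) (s t : ℕ → ℝ) (n m : ℕ) : Measure (ℝ × ℝ) :=
  ∑ i ∈ Finset.range n, ∑ j ∈ Finset.range m,
    ENNReal.ofReal (D i j) • Measure.dirac (s (i + 1), t (j + 1))

instance (D : ℕ → ℕ → ℝ) (s t : ℕ → ℝ) (n m : ℕ) : IsFiniteMeasure (gridMeasure D s t n m) := by
  constructor
  simp [gridMeasure, Measure.finsetSum_apply]

theorem gridMeasure_real (D : ℕ → ℕ → ℝ) (s t : ℕ → ℝ) (n m : ℕ) {S : Set (ℝ × ℝ)}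
    (hS : MeasurableSet S) :
    (gridMeasure D s t n m).real S = ∑ i ∈ Finset.range n, ∑ j ∈ Finset.range m,
      max (D i j) 0 * S.indicator 1 (s (i + 1), t (j + 1)) := by
  have hne : ∀ i j, ENNReal.ofReal (D i j) * S.indicator 1 (s (i + 1), t (j + 1)) ≠ ∞ := by
    intro i j
    apply ENNReal.mul_ne_top ENNReal.ofReal_ne_top
    by_cases h : (s (i + 1), t (j + 1)) ∈ S <;> simp [h]
  simp only [gridMeasure, Measure.real, Measure.finsetSum_apply, Measure.smul_apply, smul_eq_mul,
    Measure.dirac_apply' _ hS]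
  rw [ENNReal.toReal_sum fun i _ => ENNReal.sum_ne_top.2 fun j _ => hne i j]
  refine Finset.sum_congr rfl fun i _ => ?_
  rw [ENNReal.toReal_sum fun j _ => hne i j]
  refine Finset.sum_congr rfl fun j _ => ?_
  rw [ENNReal.toReal_mul, ENNReal.toReal_ofReal']
  by_cases h : (s (i + 1), t (j + 1)) ∈ S <;> simp [h]

/-- The mixed differences of `f` over the cells of a grid. -/
def cellDiff (f : ℝ × ℝ → ℝ) (s t : ℕ → ℝ) (i j : ℕ) : ℝ :=
  mixedDiff f (s i) (s (i + 1)) (t j) (t (j + 1))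

/-- Negating `D` selects its negative part. This identity and `gridMeasure_real_add` express `D = D⁺
- D⁻` and `|D| = D⁺ + D⁻`. -/
theorem gridMeasure_real_sub (D : ℕ → ℕ → ℝ) (s t : ℕ → ℝ) (n m : ℕ) {S : Set (ℝ × ℝ)}
    (hS : MeasurableSet S) :
    (gridMeasure D s t n m).real S - (gridMeasure (-D) s t n m).real S
      = ∑ i ∈ Finset.range n, ∑ j ∈ Finset.range m,
        S.indicator 1 (s (i + 1), t (j + 1)) * D i j := by
  rw [gridMeasure_real _ _ _ _ _ hS, gridMeasure_real _ _ _ _ _ hS]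
  simp only [← Finset.sum_sub_distrib]
  refine Finset.sum_congr rfl fun i _ => Finset.sum_congr rfl fun j _ => ?_
  rw [← sub_mul, mul_comm]
  congr 1
  rcases le_total (D i j) 0 with h | h <;> simp [h]

theorem gridMeasure_real_add (D : ℕ → ℕ → ℝ) (s t : ℕ → ℝ) (n m : ℕ) {S : Set (ℝ × ℝ)}
    (hS : MeasurableSet S) :
    (gridMeasure D s t n m).real S + (gridMeasure (-D) s t n m).real S
      = ∑ i ∈ Finset.range n, ∑ j ∈ Finset.range m,
        S.indicator 1 (s (i + 1), t (j + 1)) * |D i j| := by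
  rw [gridMeasure_real _ _ _ _ _ hS, gridMeasure_real _ _ _ _ _ hS]
  simp only [← Finset.sum_add_distrib]
  refine Finset.sum_congr rfl fun i _ => Finset.sum_congr rfl fun j _ => ?_
  rw [← add_mul, mul_comm]
  congr 1
  rcases le_total (D i j) 0 with h | h <;> simp [h, abs_of_nonpos, abs_of_nonneg]

theorem sum_abs_cellDiff_le {f : ℝ × ℝ → ℝ} (hf : vitaliVariation f < ∞) {s t : ℕ → ℝ}
    (hs : Monotone s) (ht : Monotone t) (n m : ℕ) :
    ∑ i ∈ Finset.range n, ∑ j ∈ Finset.range m, |cellDiff f s t i j|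
      ≤ (vitaliVariation f).toReal := by
  rw [← ENNReal.ofReal_le_iff_le_toReal hf.ne,
    ENNReal.ofReal_sum_of_nonneg fun i _ => Finset.sum_nonneg fun j _ => abs_nonneg _]
  simp only [ENNReal.ofReal_sum_of_nonneg fun j _ => abs_nonneg (cellDiff f s t _ j)]
  exact le_iSup₂_of_le n m (le_iSup₂_of_le ⟨s, hs⟩ ⟨t, ht⟩ le_rfl)

theorem exists_grid_lt_sum (f : ℝ × ℝ → ℝ) {ε : ℝ} (hε : 0 < ε) :
    ∃ (n m : ℕ) (s t : ℕ → ℝ), Monotone s ∧ Monotone t ∧ (vitaliVariation f).toReal - ε <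
      ∑ i ∈ Finset.range n, ∑ j ∈ Finset.range m, |cellDiff f s t i j| := by
  by_contra! h
  have h0 : vitaliVariation f ≤ ENNReal.ofReal ((vitaliVariation f).toReal - ε) := by
    refine iSup₂_le fun n m => iSup₂_le fun s t => ?_
    have := ENNReal.ofReal_le_ofReal (h n m s.1 t.1 s.2 t.2)
    rw [ENNReal.ofReal_sum_of_nonneg fun i _ => Finset.sum_nonneg fun j _ => abs_nonneg _] at this
    simp only [ENNReal.ofReal_sum_of_nonneg fun j _ => abs_nonneg (cellDiff f s.1 t.1 _ j)] at this
    exact this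
  -- The empty grid shows that variation minus `ε` is nonnegative, so that `ENNReal.ofReal` does not
  -- truncate it.
  have h1 := h 0 0 (fun _ => 0) (fun _ => 0) monotone_const monotone_const
  simp only [Finset.range_zero, Finset.sum_empty] at h1
  have := ENNReal.toReal_mono ENNReal.ofReal_ne_top h0
  rw [ENNReal.toReal_ofReal h1] at this
  linarith

/-- The difference over a coarse cell is the sum of those over the fine cells inside it, so the
triangle inequality applies. Summed over coarse cells the weights telescope to the indicator of the
whole coarse rectangle: only fine cells inside it are counted, which is what tightness needs. -/
theorem sum_abs_cellDiff_le_of_refines (f : ℝ × ℝ → ℝ) {s t s₀ t₀ : ℕ → ℝ} {n m n₀ m₀ : ℕ}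
    (hs : Monotone s) (ht : Monotone t) (hs₀ : Monotone s₀) (ht₀ : Monotone t₀)
    (hrs : ∀ k ≤ n₀, ∃ i ≤ n, s i = s₀ k) (hrt : ∀ k ≤ m₀, ∃ i ≤ m, t i = t₀ k) :
    ∑ k ∈ Finset.range n₀, ∑ l ∈ Finset.range m₀, |cellDiff f s₀ t₀ k l| ≤
      ∑ i ∈ Finset.range n, ∑ j ∈ Finset.range m,
        ((iicInd (s₀ n₀) (s (i + 1)) - iicInd (s₀ 0) (s (i + 1))) *
        (iicInd (t₀ m₀) (t (j + 1)) - iicInd (t₀ 0) (t (j + 1)))) * |cellDiff f s t i j| := by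
  have key : ∀ {s s₀ : ℕ → ℝ} {n n₀ : ℕ}, Monotone s → (∀ k ≤ n₀, ∃ i ≤ n, s i = s₀ k) →
      ∀ k < n₀, ∀ g : ℝ → ℝ, ∑ i ∈ Finset.range n,
        (iicInd (s₀ (k + 1)) (s (i + 1)) - iicInd (s₀ k) (s (i + 1))) *
          (g (s (i + 1)) - g (s i)) = g (s₀ (k + 1)) - g (s₀ k) := by
    intro s s₀ n n₀ hs h k hk g
    obtain ⟨i, hi, hik⟩ := h k hk.le
    obtain ⟨i', hi', hik'⟩ := h (k + 1) hk
    simp only [sub_mul, Finset.sum_sub_distrib]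
    rw [← hik, ← hik', sum_iicInd_mul_sub hs hi, sum_iicInd_mul_sub hs hi']
    ring
  calc
    _ ≤ ∑ k ∈ Finset.range n₀, ∑ l ∈ Finset.range m₀, ∑ i ∈ Finset.range n, ∑ j ∈ Finset.range m,
        ((iicInd (s₀ (k + 1)) (s (i + 1)) - iicInd (s₀ k) (s (i + 1))) *
        (iicInd (t₀ (l + 1)) (t (j + 1)) - iicInd (t₀ l) (t (j + 1)))) * |cellDiff f s t i j| := by
      refine Finset.sum_le_sum fun k hk => Finset.sum_le_sum fun l hl => ?_
      have := sum_mul_mixedDiff f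
        (w := fun u => iicInd (s₀ (k + 1)) u - iicInd (s₀ k) u)
        (z := fun u => iicInd (t₀ (l + 1)) u - iicInd (t₀ l) u) (key hs hrs k (Finset.mem_range.1 hk))
        (key ht hrt l (Finset.mem_range.1 hl))
      rw [cellDiff, ← this]
      refine (Finset.abs_sum_le_sum_abs _ _).trans (Finset.sum_le_sum fun i _ => ?_)
      refine (Finset.abs_sum_le_sum_abs _ _).trans (Finset.sum_le_sum fun j _ => ?_)
      rw [abs_mul, abs_mul, abs_of_nonneg (sub_nonneg.2 (iicInd_mono _ (hs₀ (Nat.le_succ k)))),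
        abs_of_nonneg (sub_nonneg.2 (iicInd_mono _ (ht₀ (Nat.le_succ l))))]
      rfl
    _ = ∑ i ∈ Finset.range n, ∑ j ∈ Finset.range m, ∑ k ∈ Finset.range n₀, ∑ l ∈ Finset.range m₀,
        ((iicInd (s₀ (k + 1)) (s (i + 1)) - iicInd (s₀ k) (s (i + 1))) *
        (iicInd (t₀ (l + 1)) (t (j + 1)) - iicInd (t₀ l) (t (j + 1)))) * |cellDiff f s t i j| := by
      rw [Finset.sum_congr rfl fun k _ => Finset.sum_comm, Finset.sum_comm]
      refine Finset.sum_congr rfl fun i _ => ?_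
      rw [Finset.sum_congr rfl fun k _ => Finset.sum_comm, Finset.sum_comm]
    _ = _ := by
      refine Finset.sum_congr rfl fun i _ => Finset.sum_congr rfl fun j _ => ?_
      simp only [← Finset.sum_mul, ← Finset.mul_sum]
      rw [Finset.sum_range_sub (fun k => iicInd (s₀ k) (s (i + 1))),
        Finset.sum_range_sub (fun k => iicInd (t₀ k) (t (j + 1)))]

/-! ### Tightness of the grid measures -/

/-- The square `[-R, R]²`. -/
def square (R : ℝ) : Set (ℝ × ℝ) := Set.Icc (-R) R ×ˢ Set.Icc (-R) R

theorem measurableSet_square (R : ℝ) : MeasurableSet (square R) :=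
  measurableSet_Icc.prod measurableSet_Icc

theorem square_mono {R R' : ℝ} (h : R ≤ R') : square R ⊆ square R' :=
  Set.prod_mono (Set.Icc_subset_Icc (neg_le_neg h) h) (Set.Icc_subset_Icc (neg_le_neg h) h)

/-- Off a suitable square, the grid measures of all sufficiently fine grids are small. -/
theorem exists_square_gridMeasure_compl_le {f : ℝ × ℝ → ℝ} (hf : vitaliVariation f < ∞) {ε : ℝ}
    (hε : 0 < ε) : ∃ (P : Finset ℝ) (R : ℝ), 0 ≤ R ∧ ∀ (s : ℕ → ℝ) (n : ℕ), Monotone s →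
      (∀ a ∈ P, ∃ i ≤ n, s i = a) →
      (gridMeasure (cellDiff f s s) s s n n).real (square R)ᶜ +
        (gridMeasure (-cellDiff f s s) s s n n).real (square R)ᶜ ≤ ε := by
  -- This grid captures the variation up to `ε`. A refinement has at least as much inside its
  -- rectangle and at most the full variation in all, so at most `ε` remains outside. `P` collects
  -- the grid points and `R` bounds the corners.
  obtain ⟨n₀, m₀, s₀, t₀, hs₀, ht₀, h₀⟩ := exists_grid_lt_sum f hε
  refine ⟨(Finset.range (n₀ + 1)).image s₀ ∪ (Finset.range (m₀ + 1)).image t₀,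
    |s₀ 0| + |s₀ n₀| + |t₀ 0| + |t₀ m₀|, by positivity, fun s n hs hP => ?_⟩
  have hr := sum_abs_cellDiff_le_of_refines f (n₀ := n₀) (m₀ := m₀) hs hs hs₀ ht₀
    (fun k hk => hP _ (Finset.mem_union_left _ (Finset.mem_image_of_mem _
      (Finset.mem_range.2 (by omega)))))
    (fun k hk => hP _ (Finset.mem_union_right _ (Finset.mem_image_of_mem _
      (Finset.mem_range.2 (by omega)))))
  have hV := sum_abs_cellDiff_le hf hs hs n n
  rw [gridMeasure_real_add _ _ _ _ _ (measurableSet_square _).compl]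
  refine le_trans ?_ (show ∑ i ∈ Finset.range n, ∑ j ∈ Finset.range n, |cellDiff f s s i j| -
    ∑ i ∈ Finset.range n, ∑ j ∈ Finset.range n,
        ((iicInd (s₀ n₀) (s (i + 1)) - iicInd (s₀ 0) (s (i + 1))) *
        (iicInd (t₀ m₀) (s (j + 1)) - iicInd (t₀ 0) (s (j + 1)))) * |cellDiff f s s i j| ≤ ε by
      linarith)
  simp only [← Finset.sum_sub_distrib]
  refine Finset.sum_le_sum fun i _ => Finset.sum_le_sum fun j _ => ?_
  -- All weights are at most 1, and a corner outside the square has weight 0.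
  rw [← one_sub_mul]
  refine mul_le_mul_of_nonneg_right ?_ (abs_nonneg _)
  have h1 := neg_abs_le (s₀ 0)
  have h2 := neg_abs_le (t₀ 0)
  have h3 := le_abs_self (s₀ n₀)
  have h4 := le_abs_self (t₀ m₀)
  have h5 := abs_nonneg (s₀ 0)
  have h6 := abs_nonneg (t₀ 0)
  have h7 := abs_nonneg (s₀ n₀)
  have h8 := abs_nonneg (t₀ m₀)
  have h9 := hs₀ (Nat.zero_le n₀)
  have h10 := ht₀ (Nat.zero_le m₀)
  classical
  rw [Set.indicator_apply]
  simp only [square, Set.mem_compl_iff, Set.mem_prod, Set.mem_Icc, iicInd, Pi.one_apply]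
  split_ifs with hsq <;> first | linarith | norm_num
  all_goals
    apply hsq
    refine ⟨⟨?_, ?_⟩, ?_, ?_⟩ <;> linarith

/-! ### Representation of a function of bounded variation by a pair of measures -/

theorem eventually_real_lt_of_tendsto {ι : Type*} {L : Filter ι} {μs : ι → FiniteMeasure (ℝ × ℝ)}
    {μ : FiniteMeasure (ℝ × ℝ)} (h : Tendsto μs L (𝓝 μ)) {F : Set (ℝ × ℝ)} (hF : IsClosed F)
    {ε : ℝ} (hε : 0 < ε) :
    ∀ᶠ i in L, (μs i : Measure (ℝ × ℝ)).real F < (μ : Measure (ℝ × ℝ)).real F + ε := by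
  have h1 := FiniteMeasure.limsup_measure_closed_le_of_tendsto h hF
  have h2 : (μ : Measure (ℝ × ℝ)) F < (μ : Measure (ℝ × ℝ)) F + ENNReal.ofReal ε :=
    ENNReal.lt_add_right (measure_ne_top _ _) (by simpa using hε)
  filter_upwards [eventually_lt_of_limsup_lt (h1.trans_lt h2)] with i hi
  have := (ENNReal.toReal_lt_toReal (measure_ne_top _ _) (by finiteness)).2 hi
  rwa [ENNReal.toReal_add (measure_ne_top _ _) (by finiteness), ENNReal.toReal_ofReal hε.le]
    at this

/-- Open half of the portmanteau theorem, from the closed half for the complement; since these are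
not probability measures, convergence of the total masses is needed too. -/
theorem eventually_lt_real_of_tendsto {ι : Type*} {L : Filter ι} {μs : ι → FiniteMeasure (ℝ × ℝ)}
    {μ : FiniteMeasure (ℝ × ℝ)} (h : Tendsto μs L (𝓝 μ)) {G : Set (ℝ × ℝ)} (hG : IsOpen G)
    {ε : ℝ} (hε : 0 < ε) :
    ∀ᶠ i in L, (μ : Measure (ℝ × ℝ)).real G - ε < (μs i : Measure (ℝ × ℝ)).real G := by
  have hm : Tendsto (fun i => (μs i : Measure (ℝ × ℝ)).real Set.univ) L
      (𝓝 ((μ : Measure (ℝ × ℝ)).real Set.univ)) :=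
    (NNReal.continuous_coe.tendsto _).comp h.mass
  filter_upwards [eventually_real_lt_of_tendsto h hG.isClosed_compl (half_pos hε),
    hm.eventually_const_lt (sub_lt_self _ (half_pos hε))] with i h1 h2
  have h3 := measureReal_add_measureReal_compl (μ := (μ : Measure (ℝ × ℝ))) hG.measurableSet
  have h4 := measureReal_add_measureReal_compl (μ := (μs i : Measure (ℝ × ℝ))) hG.measurableSet
  linarith

/-- Index of the net of grids: a finite set of grid points and a precision. -/
abbrev GridIndex : Type := Finset ℝ × ℕ

/-- Prokhorov's theorem: bounded mass and uniform tightness give relative compactness. The index set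
is a net of grids, so an ultrafilter replaces a subsequence. -/
theorem exists_tendsto_ultrafilter {μs : GridIndex → FiniteMeasure (ℝ × ℝ)} {C : ℝ} {R : ℕ → ℝ}
    (hC : ∀ i, (μs i : Measure (ℝ × ℝ)).real Set.univ ≤ C)
    (hR : ∀ i n, (μs i : Measure (ℝ × ℝ)).real (square (R n))ᶜ ≤ 1 / ((n : ℝ) + 1))
    (U : Ultrafilter GridIndex) : ∃ μ : FiniteMeasure (ℝ × ℝ), Tendsto μs U (𝓝 μ) := by
  have hu : Tendsto (fun n : ℕ => (1 / ((n : NNReal) + 1))) atTop (𝓝 0) :=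
    tendsto_one_div_add_atTop_nhds_zero_nat
  have hK : IsCompact {μ : FiniteMeasure (ℝ × ℝ) | μ.mass ≤ C.toNNReal ∧
      ∀ n, μ (square (R n))ᶜ ≤ 1 / ((n : NNReal) + 1)} :=
    isCompact_setOfPred_finiteMeasure_mass_le_compl_isCompact_le C.toNNReal hu
      (fun n => isCompact_Icc.prod isCompact_Icc) (Or.inl inferInstance)
  rw [isCompact_iff_ultrafilter_le_nhds] at hK
  obtain ⟨μ, -, hμ⟩ := hK (U.map μs) (by
    rw [Ultrafilter.coe_map, le_principal_iff, mem_map]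
    refine univ_mem' fun i => ⟨?_, fun n => ?_⟩
    · exact NNReal.le_toNNReal_of_coe_le (hC i)
    · rw [← NNReal.coe_le_coe]
      simpa using! hR i n)
  exact ⟨μ, hμ⟩

theorem MemBVVanishing.exists_lt {f : ℝ × ℝ → ℝ} (hf : MemBVVanishing f) {ε : ℝ} (hε : 0 < ε) :
    ∃ M : ℝ, 0 < M ∧ ∀ p : ℝ × ℝ, M ≤ ‖p‖ → |f p| < ε := by
  have := hf.vanishing.eventually (Metric.ball_mem_nhds 0 hε)
  rw [eventually_comap] at this
  obtain ⟨M, hM⟩ := eventually_atTop.1 this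
  refine ⟨max M 1, by positivity, fun p hp => ?_⟩
  simpa using hM ‖p‖ ((le_max_left _ _).trans hp) p rfl

/-- Weak limits control open and closed sets from one side each, and the values of `f` on lines
carrying mass are not determined by `μ - ν`; hence a sandwich instead of an equality. -/
theorem MemBVVanishing.exists_measures {f : ℝ × ℝ → ℝ} (hf : MemBVVanishing f) :
    ∃ μ ν : Measure (ℝ × ℝ), IsFiniteMeasure μ ∧ IsFiniteMeasure ν ∧ ∀ s t : ℝ,
      μ.real (Set.Iio s ×ˢ Set.Iio t) - ν.real (Set.Iic s ×ˢ Set.Iic t) ≤ f (s, t) ∧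
      f (s, t) ≤ μ.real (Set.Iic s ×ˢ Set.Iic t) - ν.real (Set.Iio s ×ˢ Set.Iio t) := by
  have hpos : ∀ n : ℕ, (0 : ℝ) < 1 / ((n : ℝ) + 1) := fun n => by positivity
  choose P R₀ hR₀ hPR using fun n => exists_square_gridMeasure_compl_le hf.boundedVariation (hpos n)
  choose e N he hmem using exists_monotone_enumeration
  -- Containing `P 0, …, P i.2`, the grid satisfies the tightness bounds `1 / (n + 1)` for all `n ≤
  -- i.2`.
  let G : GridIndex → Finset ℝ := fun i => i.1 ∪ (Finset.range (i.2 + 1)).biUnion P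
  let R : ℕ → ℝ := fun n => ∑ k ∈ Finset.range (n + 1), R₀ k
  have hRmono : Monotone R := fun a b hab => Finset.sum_le_sum_of_subset_of_nonneg
    (Finset.range_mono (by omega)) fun k _ _ => hR₀ k
  have hRle : ∀ n, R₀ n ≤ R n := fun n =>
    Finset.single_le_sum (f := R₀) (fun k _ => hR₀ k) (Finset.mem_range.2 (Nat.lt_succ_self n))
  let s : GridIndex → ℕ → ℝ := fun i => e (G i)
  let D : GridIndex → ℕ → ℕ → ℝ := fun i => cellDiff f (s i) (s i)
  let gp : GridIndex → Measure (ℝ × ℝ) := fun i => gridMeasure (D i) (s i) (s i) (N (G i)) (N (G i))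
  let gm : GridIndex → Measure (ℝ × ℝ) :=
    fun i => gridMeasure (-D i) (s i) (s i) (N (G i)) (N (G i))
  -- Restriction to the square of index `i.2` makes the bounds hold for larger `n` as well, where
  -- the outer mass is now 0, at a cost of at most `1 / (i.2 + 1)`.
  let μs : GridIndex → Measure (ℝ × ℝ) := fun i => (gp i).restrict (square (R i.2))
  let νs : GridIndex → Measure (ℝ × ℝ) := fun i => (gm i).restrict (square (R i.2))
  have hfin : ∀ i, IsFiniteMeasure (gp i) := fun i => inferInstanceAs
    (IsFiniteMeasure (gridMeasure ..))
  have hfin' : ∀ i, IsFiniteMeasure (gm i) := fun i => inferInstanceAs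
    (IsFiniteMeasure (gridMeasure ..))
  have hfinμ : ∀ i, IsFiniteMeasure (μs i) := fun i => inferInstanceAs
    (IsFiniteMeasure ((gp i).restrict _))
  have hfinν : ∀ i, IsFiniteMeasure (νs i) := fun i => inferInstanceAs
    (IsFiniteMeasure ((gm i).restrict _))
  have hsmall : ∀ i : GridIndex, ∀ n ≤ i.2,
      (gp i).real (square (R n))ᶜ + (gm i).real (square (R n))ᶜ ≤ 1 / ((n : ℝ) + 1) := by
    intro i n hn
    refine le_trans (add_le_add ?_ ?_) (hPR n (s i) (N (G i)) (he _) fun a ha => hmem (G i) a ?_)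
    · exact measureReal_mono (Set.compl_subset_compl.2 (square_mono (hRle n)))
    · exact measureReal_mono (Set.compl_subset_compl.2 (square_mono (hRle n)))
    · exact Finset.mem_union_right _ (Finset.mem_biUnion.2
        ⟨n, Finset.mem_range.2 (Nat.lt_succ_of_le hn), ha⟩)
  have hmass : ∀ i : GridIndex, (gp i).real Set.univ + (gm i).real Set.univ
      ≤ (vitaliVariation f).toReal := by
    intro i
    rw [gridMeasure_real_add _ _ _ _ _ MeasurableSet.univ]
    simpa using sum_abs_cellDiff_le hf.boundedVariation (he (G i)) (he (G i)) (N (G i)) (N (G i))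
  have tight : ∀ (g : Measure (ℝ × ℝ)) [IsFiniteMeasure g] (k : ℕ),
      (∀ n ≤ k, g.real (square (R n))ᶜ ≤ 1 / ((n : ℝ) + 1)) →
      ∀ n, (g.restrict (square (R k))).real (square (R n))ᶜ ≤ 1 / ((n : ℝ) + 1) := by
    intro g _ k h n
    rw [measureReal_restrict_apply (measurableSet_square _).compl]
    rcases le_total n k with hnk | hnk
    · exact (measureReal_mono Set.inter_subset_left).trans (h n hnk)
    · have : (square (R n))ᶜ ∩ square (R k) = ∅ := by
        rw [← Set.disjoint_iff_inter_eq_empty, Set.disjoint_compl_left_iff_subset]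
        exact square_mono (hRmono hnk)
      rw [this, measureReal_empty]
      positivity
  let U : Ultrafilter GridIndex := Ultrafilter.of atTop
  have hU : (U : Filter GridIndex) ≤ atTop := Ultrafilter.of_le _
  obtain ⟨μ, hμ⟩ := exists_tendsto_ultrafilter (μs := fun i => ⟨μs i, hfinμ i⟩) (C := (vitaliVariation f).toReal) (R := R)
    (fun i => by
      refine le_trans ?_ (hmass i)
      have : (μs i).real Set.univ ≤ (gp i).real Set.univ := by
        simp only [μs, measureReal_restrict_apply MeasurableSet.univ]
        exact measureReal_mono Set.inter_subset_left
      exact this.trans (le_add_of_nonneg_right measureReal_nonneg))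
    (fun i => tight (gp i) i.2 fun n hn =>
      le_trans (le_add_of_nonneg_right measureReal_nonneg) (hsmall i n hn)) U
  obtain ⟨ν, hν⟩ := exists_tendsto_ultrafilter (μs := fun i => ⟨νs i, hfinν i⟩) (C := (vitaliVariation f).toReal) (R := R)
    (fun i => by
      refine le_trans ?_ (hmass i)
      have : (νs i).real Set.univ ≤ (gm i).real Set.univ := by
        simp only [νs, measureReal_restrict_apply MeasurableSet.univ]
        exact measureReal_mono Set.inter_subset_left
      exact this.trans (le_add_of_nonneg_left measureReal_nonneg))
    (fun i => tight (gm i) i.2 fun n hn =>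
      le_trans (le_add_of_nonneg_left measureReal_nonneg) (hsmall i n hn)) U
  -- With `-M` in the grid, its first point is at most `-M`, so three of the four corner values of
  -- `f` are below `ε`; the fourth `ε` pays for the restriction to the square.
  have happrox : ∀ p q : ℝ, ∀ ε > 0, ∀ᶠ i in (U : Filter GridIndex),
      |(μs i).real (Set.Iic p ×ˢ Set.Iic q) - (νs i).real (Set.Iic p ×ˢ Set.Iic q) - f (p, q)|
        ≤ 4 * ε := by
    intro p q ε hε
    obtain ⟨M, hM0, hM⟩ := hf.exists_lt hε
    obtain ⟨k, hk⟩ := exists_nat_one_div_lt hε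
    refine hU ((eventually_ge_atTop (({p, q, -M} : Finset ℝ), k)).mono fun i hi => ?_)
    have hsub : ({p, q, -M} : Finset ℝ) ⊆ i.1 := hi.1
    have hki : k ≤ i.2 := hi.2
    have hin : ∀ a ∈ ({p, q, -M} : Finset ℝ), ∃ j ≤ N (G i), s i j = a :=
      fun a ha => hmem _ _ (Finset.mem_union_left _ (hsub ha))
    obtain ⟨jp, hjp, hp⟩ := hin p (by simp)
    obtain ⟨jq, hjq, hq⟩ := hin q (by simp)
    obtain ⟨jM, hjM, hsM⟩ := hin (-M) (by simp)
    have hs0 : s i 0 ≤ -M := hsM ▸ he (G i) (Nat.zero_le jM)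
    have hS : MeasurableSet (Set.Iic p ×ˢ Set.Iic q) := measurableSet_Iic.prod measurableSet_Iic
    have hgrid : (gp i).real (Set.Iic p ×ˢ Set.Iic q) - (gm i).real (Set.Iic p ×ˢ Set.Iic q)
        = mixedDiff f (s i 0) p (s i 0) q := by
      have := sum_mul_mixedDiff f (s := s i) (t := s i) (n := N (G i)) (m := N (G i))
        (w := iicInd p) (z := iicInd q) (a := s i 0) (b := p) (c := s i 0) (d := q)
        (fun g => by rw [← hp]; exact sum_iicInd_mul_sub (he _) hjp g)
        (fun g => by rw [← hq]; exact sum_iicInd_mul_sub (he _) hjq g)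
      rw [← this, gridMeasure_real_sub _ _ _ _ _ hS]
      refine Finset.sum_congr rfl fun a _ => Finset.sum_congr rfl fun b _ => ?_
      congr 1
      by_cases h1 : s i (a + 1) ≤ p <;> by_cases h2 : s i (b + 1) ≤ q <;> simp [iicInd, h1, h2]
    have habs : M ≤ |s i 0| := by
      rw [abs_of_nonpos (by linarith)]
      linarith
    have b1 := abs_lt.1 (hM (s i 0, q) (habs.trans (le_max_left _ _)))
    have b2 := abs_lt.1 (hM (p, s i 0) (habs.trans (le_max_right _ _)))
    have b3 := abs_lt.1 (hM (s i 0, s i 0) (habs.trans (le_max_left _ _)))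
    have hrest : ∀ (g : Measure (ℝ × ℝ)) [IsFiniteMeasure g] (K : Set (ℝ × ℝ)), MeasurableSet K →
        (g.restrict K).real (Set.Iic p ×ˢ Set.Iic q) ≤ g.real (Set.Iic p ×ˢ Set.Iic q) ∧
        g.real (Set.Iic p ×ˢ Set.Iic q) ≤ (g.restrict K).real (Set.Iic p ×ˢ Set.Iic q)
          + g.real Kᶜ := by
      intro g _ K hK
      rw [measureReal_restrict_apply hS]
      refine ⟨measureReal_mono Set.inter_subset_left, ?_⟩
      rw [← measureReal_inter_add_sdiff (μ := g) (s := Set.Iic p ×ˢ Set.Iic q) hK]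
      exact add_le_add le_rfl (measureReal_mono fun x hx => hx.2)
    have r1 := hrest (gp i) _ (measurableSet_square (R i.2))
    have r2 := hrest (gm i) _ (measurableSet_square (R i.2))
    have r3 := hsmall i i.2 le_rfl
    have r4 : 1 / ((i.2 : ℝ) + 1) ≤ 1 / ((k : ℝ) + 1) := by
      gcongr
    have r5 := measureReal_nonneg (μ := gp i) (s := (square (R i.2))ᶜ)
    have r6 := measureReal_nonneg (μ := gm i) (s := (square (R i.2))ᶜ)
    simp only [mixedDiff] at hgrid
    simp only [μs, νs]
    rw [abs_le]
    constructor <;> linarith [r1.1, r1.2, r2.1, r2.2, b1.1, b1.2, b2.1, b2.2, b3.1, b3.2]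
  refine ⟨μ, ν, inferInstance, inferInstance, fun p q => ⟨?_, ?_⟩⟩
  -- The share `ε / 6` is spent once for each of the two portmanteau bounds and four times in
  -- `happrox`.
  · refine le_of_forall_pos_le_add fun ε hε => ?_
    have h1 := eventually_lt_real_of_tendsto hμ (isOpen_Iio.prod isOpen_Iio :
      IsOpen (Set.Iio p ×ˢ Set.Iio q)) (show 0 < ε / 6 by positivity)
    have h2 := eventually_real_lt_of_tendsto hν (isClosed_Iic.prod isClosed_Iic :
      IsClosed (Set.Iic p ×ˢ Set.Iic q)) (show 0 < ε / 6 by positivity)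
    obtain ⟨i, h1, h2, h3⟩ := (h1.and (h2.and (happrox p q (ε / 6) (by positivity)))).exists
    simp only [FiniteMeasure.toMeasure_mk] at h1 h2
    have h4 : (μs i).real (Set.Iio p ×ˢ Set.Iio q) ≤ (μs i).real (Set.Iic p ×ˢ Set.Iic q) :=
      measureReal_mono (Set.prod_mono Set.Iio_subset_Iic_self Set.Iio_subset_Iic_self)
    have h5 := abs_le.1 h3
    linarith [h5.1, h5.2]
  · refine le_of_forall_pos_le_add fun ε hε => ?_
    have h1 := eventually_lt_real_of_tendsto hν (isOpen_Iio.prod isOpen_Iio :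
      IsOpen (Set.Iio p ×ˢ Set.Iio q)) (show 0 < ε / 6 by positivity)
    have h2 := eventually_real_lt_of_tendsto hμ (isClosed_Iic.prod isClosed_Iic :
      IsClosed (Set.Iic p ×ˢ Set.Iic q)) (show 0 < ε / 6 by positivity)
    obtain ⟨i, h1, h2, h3⟩ := (h1.and (h2.and (happrox p q (ε / 6) (by positivity)))).exists
    simp only [FiniteMeasure.toMeasure_mk] at h1 h2
    have h4 : (νs i).real (Set.Iio p ×ˢ Set.Iio q) ≤ (νs i).real (Set.Iic p ×ˢ Set.Iic q) :=
      measureReal_mono (Set.prod_mono Set.Iio_subset_Iic_self Set.Iio_subset_Iic_self)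
    have h5 := abs_le.1 h3
    linarith [h5.1, h5.2]

/-! ### The sine integral -/

/-- The sine integral `∫₀ˣ sin t / t dt`. -/
noncomputable def sinInt (x : ℝ) : ℝ := ∫ t in (0 : ℝ)..x, Real.sinc t

theorem hasDerivAt_sinInt (x : ℝ) : HasDerivAt sinInt (Real.sinc x) x :=
  intervalIntegral.integral_hasDerivAt_right (Real.continuous_sinc.intervalIntegrable _ _)
    (Real.continuous_sinc.stronglyMeasurableAtFilter _ _) Real.continuous_sinc.continuousAt

theorem continuous_sinInt : Continuous sinInt :=
  continuous_iff_continuousAt.2 fun x => (hasDerivAt_sinInt x).continuousAt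

@[simp] theorem sinInt_zero : sinInt 0 = 0 := by simp [sinInt]

theorem sinInt_neg (x : ℝ) : sinInt (-x) = -sinInt x := by
  have h := intervalIntegral.integral_comp_neg (a := 0) (b := x) Real.sinc
  simp only [Real.sinc_neg, neg_zero] at h
  rw [sinInt, sinInt, h, intervalIntegral.integral_symm]

theorem integral_mul_sinc (w a b : ℝ) :
    ∫ ξ in a..b, w * Real.sinc (w * ξ) = sinInt (w * b) - sinInt (w * a) := by
  have hd : ∀ ξ ∈ Set.uIcc a b,
      HasDerivAt (fun ξ => sinInt (w * ξ)) (w * Real.sinc (w * ξ)) ξ := by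
    intro ξ _
    have := (hasDerivAt_sinInt (w * ξ)).comp ξ ((hasDerivAt_id ξ).const_mul w)
    simpa [mul_comm, Function.comp_def] using this
  refine intervalIntegral.integral_eq_sub_of_hasDerivAt hd (Continuous.intervalIntegrable ?_ _ _)
  exact continuous_const.mul (Real.continuous_sinc.comp (continuous_const.mul continuous_id))

/-- Integration by parts: adding `cos x / x` turns the derivative into the absolutely integrable
`-cos x / x ^ 2`. -/
theorem exists_tendsto_sinInt : ∃ c, Tendsto sinInt atTop (𝓝 c) := by
  have hd : ∀ x ∈ Set.Ioi (1 : ℝ),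
      HasDerivAt (fun x => sinInt x + Real.cos x / x) (-(Real.cos x * (x ^ 2)⁻¹)) x := by
    intro x hx
    have hx0 : x ≠ 0 := (zero_lt_one.trans hx).ne'
    refine ((hasDerivAt_sinInt x).add ((Real.hasDerivAt_cos x).div (hasDerivAt_id x) hx0)).congr_deriv
      ?_
    rw [Real.sinc_of_ne_zero hx0]
    simp only [id]
    field_simp
    ring
  have hint : IntegrableOn (fun x : ℝ => -(Real.cos x * (x ^ 2)⁻¹)) (Set.Ioi 1) := by
    have h := (integrableOn_Ioi_rpow_of_lt (by norm_num : (-2 : ℝ) < -1) zero_lt_one)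
    refine Integrable.mono' h ?_ ?_
    · exact Measurable.aestronglyMeasurable (by fun_prop)
    · filter_upwards [ae_restrict_mem measurableSet_Ioi] with x hx
      have hx0 : 0 < x := zero_lt_one.trans hx
      rw [Real.rpow_neg hx0.le, norm_neg, norm_mul, norm_inv, Real.rpow_ofNat, norm_pow,
        Real.norm_of_nonneg hx0.le]
      exact mul_le_of_le_one_left (by positivity) (Real.abs_cos_le_one x)
  have h1 := tendsto_limUnder_of_hasDerivAt_of_integrableOn_Ioi hd hint
  have h2 : Tendsto (fun x : ℝ => Real.cos x / x) atTop (𝓝 0) := by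
    refine squeeze_zero_norm' ?_ tendsto_inv_atTop_zero
    filter_upwards [eventually_gt_atTop 0] with x hx
    rw [norm_div, Real.norm_of_nonneg hx.le, div_eq_mul_inv]
    exact mul_le_of_le_one_left (by positivity) (Real.abs_cos_le_one x)
  exact ⟨_, by simpa using h1.sub h2⟩

theorem exists_abs_sinInt_le : ∃ C, ∀ x, |sinInt x| ≤ C := by
  obtain ⟨c, hc⟩ := exists_tendsto_sinInt
  obtain ⟨X, hX⟩ := eventually_atTop.1 (hc.abs.eventually_lt_const (lt_add_one |c|))
  obtain ⟨C, hC⟩ := (isCompact_Icc (a := (0 : ℝ)) (b := X)).exists_bound_of_continuousOn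
    continuous_sinInt.continuousOn
  have hpos : ∀ x, 0 ≤ x → |sinInt x| ≤ max (|c| + 1) C := by
    intro x hx
    rcases le_total X x with h | h
    · exact (hX x h).le.trans (le_max_left _ _)
    · exact (hC x ⟨hx, h⟩).trans (le_max_right _ _)
  refine ⟨max (|c| + 1) C, fun x => ?_⟩
  rcases le_total 0 x with h | h
  · exact hpos x h
  · rw [← abs_neg, ← sinInt_neg]
    exact hpos _ (neg_nonneg.2 h)

theorem integral_exp_neg_mul_mul_sinc {ξ : ℝ} (hξ : ξ ≠ 0) :
    ∫ w in Set.Ioi (0 : ℝ), Real.exp (-w) * (w * Real.sinc (w * ξ)) = (1 + ξ ^ 2)⁻¹ := by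
  have hp : 0 < 1 + ξ ^ 2 := by positivity
  have h1 : ∫ w in Set.Ioi (0 : ℝ), Real.exp (-w) * (w * Real.sinc (w * ξ))
      = ∫ w in Set.Ioi (0 : ℝ), Real.exp (-w) * Real.sin (w * ξ) / ξ := by
    refine setIntegral_congr_fun measurableSet_Ioi fun w hw => ?_
    have hw0 : w ≠ 0 := (Set.mem_Ioi.1 hw).ne'
    simp only [Real.sinc_of_ne_zero (mul_ne_zero hw0 hξ)]
    field_simp
  have hd : ∀ w ∈ Set.Ici (0 : ℝ), HasDerivAt
      (fun w => -(Real.exp (-w) * ((Real.sin (w * ξ) + ξ * Real.cos (w * ξ)) / (ξ * (1 + ξ ^ 2)))))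
      (Real.exp (-w) * Real.sin (w * ξ) / ξ) w := by
    intro w _
    have e1 : HasDerivAt (fun w => Real.exp (-w)) (-Real.exp (-w)) w := by
      simpa using (hasDerivAt_neg w).exp
    have e2 : HasDerivAt (fun w => Real.sin (w * ξ)) (Real.cos (w * ξ) * ξ) w := by
      simpa using ((hasDerivAt_id w).mul_const ξ).sin
    have e3 : HasDerivAt (fun w => Real.cos (w * ξ)) (-Real.sin (w * ξ) * ξ) w := by
      simpa using ((hasDerivAt_id w).mul_const ξ).cos
    refine (e1.mul ((e2.add (e3.const_mul ξ)).div_const (ξ * (1 + ξ ^ 2)))).neg.congr_deriv ?_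
    simp only [Pi.add_apply]
    field_simp
    ring
  have hint : IntegrableOn (fun w => Real.exp (-w) * Real.sin (w * ξ) / ξ) (Set.Ioi 0) := by
    refine Integrable.div_const ?_ ξ
    refine Integrable.mono' (integrableOn_exp_neg_Ioi 0) ?_ ?_
    · exact Measurable.aestronglyMeasurable (by fun_prop)
    · refine Eventually.of_forall fun w => ?_
      rw [norm_mul, Real.norm_of_nonneg (Real.exp_pos _).le]
      exact mul_le_of_le_one_right (Real.exp_pos _).le (Real.abs_sin_le_one _)
  have hlim : Tendsto (fun w => -(Real.exp (-w) *
      ((Real.sin (w * ξ) + ξ * Real.cos (w * ξ)) / (ξ * (1 + ξ ^ 2))))) atTop (𝓝 0) := by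
    rw [← neg_zero]
    refine Tendsto.neg (Tendsto.zero_mul_isBoundedUnder_le
      (Real.tendsto_exp_atBot.comp tendsto_neg_atTop_atBot) ?_)
    refine isBoundedUnder_of ⟨(1 + |ξ|) / |ξ * (1 + ξ ^ 2)|, fun w => ?_⟩
    simp only [Function.comp, Real.norm_eq_abs, abs_div]
    gcongr
    refine (abs_add_le _ _).trans (add_le_add (Real.abs_sin_le_one _) ?_)
    rw [abs_mul]
    exact mul_le_of_le_one_right (abs_nonneg _) (Real.abs_cos_le_one _)
  rw [h1, integral_Ioi_of_hasDerivAt_of_tendsto' hd hint hlim]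
  simp only [zero_mul, Real.sin_zero, Real.cos_zero, neg_zero, Real.exp_zero]
  field_simp
  ring

/-- Fubini: write `sinInt (w * β)` as an integral over `0 < ξ ≤ β`. The `w`-integral is then a
Laplace transform of the sine, with value `1 / (1 + ξ ^ 2)`. -/
theorem integral_exp_neg_mul_sinInt {β : ℝ} (hβ : 0 ≤ β) :
    ∫ w in Set.Ioi (0 : ℝ), Real.exp (-w) * sinInt (w * β) = Real.arctan β := by
  have hF : Integrable (Function.uncurry fun w ξ : ℝ => Real.exp (-w) * (w * Real.sinc (w * ξ)))
      ((volume.restrict (Set.Ioi 0)).prod (volume.restrict (Set.Ioc 0 β))) := by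
    have hg : IntegrableOn (fun w : ℝ => Real.exp (-w) * w) (Set.Ioi 0) := by
      have := Real.GammaIntegral_convergent (s := 2) (by norm_num)
      refine this.congr_fun (fun w _ => ?_) measurableSet_Ioi
      norm_num
    have hg' := Integrable.mul_prod (ν := volume.restrict (Set.Ioc 0 β)) hg
      (integrable_const (1 : ℝ))
    refine hg'.mono ?_ (Eventually.of_forall fun p => ?_)
    · exact Continuous.aestronglyMeasurable (by
        unfold Function.uncurry
        exact (Real.continuous_exp.comp continuous_fst.neg).mul (continuous_fst.mul
          (Real.continuous_sinc.comp (continuous_fst.mul continuous_snd))))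
    · simp only [Function.uncurry, norm_mul, mul_one]
      rw [← mul_assoc]
      exact mul_le_of_le_one_right (by positivity) (Real.abs_sinc_le_one _)
  have h := integral_integral_swap hF
  calc
    _ = ∫ w in Set.Ioi (0 : ℝ), ∫ ξ in Set.Ioc 0 β, Real.exp (-w) * (w * Real.sinc (w * ξ)) := by
      refine setIntegral_congr_fun measurableSet_Ioi fun w _ => ?_
      simp only [integral_const_mul (Real.exp (-w)), ← intervalIntegral.integral_of_le hβ]
      rw [integral_mul_sinc]
      simp
    _ = ∫ ξ in Set.Ioc 0 β, (1 + ξ ^ 2)⁻¹ := by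
      rw [h]
      refine setIntegral_congr_fun measurableSet_Ioc fun ξ hξ => ?_
      exact integral_exp_neg_mul_mul_sinc hξ.1.ne'
    _ = _ := by
      rw [← intervalIntegral.integral_of_le hβ, integral_inv_one_add_sq]
      simp

/-- The limit `c` exists, so the average of `sinInt (w * β)` against `exp (-w)` tends to `c` by
dominated convergence; that average is `arctan β`, which tends to `π / 2`. -/
theorem tendsto_sinInt_atTop : Tendsto sinInt atTop (𝓝 (Real.pi / 2)) := by
  obtain ⟨c, hc⟩ := exists_tendsto_sinInt
  obtain ⟨C, hC⟩ := exists_abs_sinInt_le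
  have h1 : Tendsto (fun β : ℝ => ∫ w in Set.Ioi (0 : ℝ), Real.exp (-w) * sinInt (w * β)) atTop
      (𝓝 (∫ w in Set.Ioi (0 : ℝ), Real.exp (-w) * c)) := by
    refine tendsto_integral_filter_of_dominated_convergence (fun w => Real.exp (-w) * C) ?_ ?_ ?_ ?_
    · refine Eventually.of_forall fun β => Continuous.aestronglyMeasurable ?_
      exact (Real.continuous_exp.comp continuous_neg).mul
        (continuous_sinInt.comp (continuous_id.mul continuous_const))
    · refine Eventually.of_forall fun β => Eventually.of_forall fun w => ?_
      rw [norm_mul, Real.norm_of_nonneg (Real.exp_pos _).le]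
      exact mul_le_mul_of_nonneg_left (hC _) (Real.exp_pos _).le
    · exact (integrableOn_exp_neg_Ioi 0).mul_const C
    · filter_upwards [ae_restrict_mem measurableSet_Ioi] with w hw
      exact (hc.comp (tendsto_id.const_mul_atTop hw)).const_mul _
  have h2 : Tendsto (fun β : ℝ => ∫ w in Set.Ioi (0 : ℝ), Real.exp (-w) * sinInt (w * β)) atTop
      (𝓝 (Real.pi / 2)) := by
    refine (tendsto_nhds_of_tendsto_nhdsWithin Real.tendsto_arctan_atTop).congr' ?_
    filter_upwards [eventually_ge_atTop 0] with β hβ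
    exact (integral_exp_neg_mul_sinInt hβ).symm
  have h3 := tendsto_nhds_unique h1 h2
  rw [integral_mul_const, integral_exp_neg_Ioi_zero, one_mul] at h3
  rwa [← h3]

theorem tendsto_sinInt_mul_atTop (w : ℝ) :
    Tendsto (fun β => sinInt (w * β)) atTop (𝓝 (Real.pi / 2 * SignType.sign w)) := by
  rcases lt_trichotomy w 0 with h | rfl | h
  · simp only [sign_neg h, SignType.coe_neg_one, mul_neg, mul_one]
    have := (tendsto_sinInt_atTop.comp (tendsto_id.const_mul_atTop (neg_pos.2 h))).neg
    refine this.congr fun β => ?_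
    simp [sinInt_neg]
  · simp
  · simp only [sign_pos h, SignType.coe_one, mul_one]
    exact tendsto_sinInt_atTop.comp (tendsto_id.const_mul_atTop h)

/-! ### The inversion kernel over a symmetric pair of intervals -/

/-- The set of frequencies `ξ` with `α ≤ |ξ| ≤ β`. -/
def annulus (α β : ℝ) : Set ℝ := {ξ | α ≤ |ξ| ∧ |ξ| ≤ β}

theorem annulus_eq {α β : ℝ} (hα : 0 < α) :
    annulus α β = Set.Icc α β ∪ Set.Icc (-β) (-α) := by
  ext ξ
  simp only [annulus, Set.mem_ofPred_eq, Set.mem_union, Set.mem_Icc]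
  rcases abs_cases ξ with ⟨h, h'⟩ | ⟨h, h'⟩ <;> rw [h] <;> constructor
  · exact fun h => Or.inl h
  · rintro (h | h)
    · exact h
    · linarith [h.2]
  · exact fun h => Or.inr ⟨by linarith [h.2], by linarith [h.1]⟩
  · rintro (h | h)
    · linarith [h.1]
    · exact ⟨by linarith [h.2], by linarith [h.1]⟩

theorem measurableSet_annulus (α β : ℝ) : MeasurableSet (annulus α β) :=
  (measurableSet_le measurable_const measurable_norm).inter
    (measurableSet_le measurable_norm measurable_const)

/-- The one-dimensional inversion kernel integrates to a difference of sine integrals. -/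
theorem integral_annulus {α β : ℝ} (hα : 0 < α) (hαβ : α < β) (w : ℝ) :
    ∫ ξ in annulus α β, Complex.exp (Complex.I * (w * ξ : ℝ)) / (Complex.I * ξ)
      = ((2 * (sinInt (w * β) - sinInt (w * α)) : ℝ) : ℂ) := by
  have hc : ContinuousOn (fun ξ : ℝ => Complex.exp (Complex.I * (w * ξ : ℝ)) / (Complex.I * ξ))
      {0}ᶜ := by
    refine ContinuousOn.div (by fun_prop) (by fun_prop) fun ξ hξ => ?_
    simpa using hξ
  have hi : ∀ a b : ℝ, (0 : ℝ) ∉ Set.Icc a b → IntegrableOn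
      (fun ξ : ℝ => Complex.exp (Complex.I * (w * ξ : ℝ)) / (Complex.I * ξ)) (Set.Icc a b) :=
    fun a b h => (hc.mono fun ξ hξ h0 => h (h0 ▸ hξ)).integrableOn_compact isCompact_Icc
  have h1 : (0 : ℝ) ∉ Set.Icc α β := fun h => absurd h.1 (not_le.2 hα)
  have h2 : (0 : ℝ) ∉ Set.Icc (-β) (-α) := fun h => by linarith [h.2]
  have h1' : ∀ ξ ∈ Set.uIcc α β, ξ ≠ 0 := fun ξ hξ h0 => h1 (by
    rwa [Set.uIcc_of_le hαβ.le, h0] at hξ)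
  -- The negative interval is reflected onto the positive one: the odd cosine part cancels and the
  -- sine part doubles, leaving `2 * (w * sinc (w * ξ))`.
  rw [annulus_eq hα, setIntegral_union _ measurableSet_Icc (hi _ _ h1) (hi _ _ h2),
    integral_Icc_eq_integral_Ioc, integral_Icc_eq_integral_Ioc,
    ← intervalIntegral.integral_of_le hαβ.le, ← intervalIntegral.integral_of_le (by linarith),
    ← intervalIntegral.integral_comp_neg, ← intervalIntegral.integral_add,
    ← integral_mul_sinc, ← intervalIntegral.integral_const_mul, ← intervalIntegral.integral_ofReal]
  · refine intervalIntegral.integral_congr fun ξ hξ => ?_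
    have h0 := h1' ξ hξ
    have h0' : (ξ : ℂ) ≠ 0 := by exact_mod_cast h0
    rcases eq_or_ne w 0 with rfl | hw
    · simp [div_neg]
    · simp only [Real.sinc_of_ne_zero (mul_ne_zero hw h0)]
      have hw' : (w : ℂ) ≠ 0 := by exact_mod_cast hw
      push_cast
      rw [Complex.sin]
      have e1 : Complex.I * (w * ξ) = w * ξ * Complex.I := by ring
      have e2 : Complex.I * (w * -ξ) = -(w * ξ) * Complex.I := by ring
      rw [e1, e2]
      field_simp
      rw [Complex.I_sq]
      ring
  · exact (hc.mono fun ξ hξ => h1' ξ hξ).intervalIntegrable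
  · have : ContinuousOn (fun ξ : ℝ => Complex.exp (Complex.I * (w * (-ξ) : ℝ)) /
        (Complex.I * ((-ξ : ℝ) : ℂ))) (Set.uIcc α β) :=
      hc.comp continuous_neg.continuousOn fun ξ hξ => neg_ne_zero.2 (h1' ξ hξ)
    exact this.intervalIntegrable
  · rw [Set.disjoint_left]
    rintro ξ ⟨h3, -⟩ ⟨-, h4⟩
    linarith

/-! ### Consequences of the representation -/

/-- `f` lies between the open and the closed distribution functions of the signed measure `μ - ν`. -/
structure Represents (μ ν : Measure (ℝ × ℝ)) (f : ℝ × ℝ → ℝ) : Prop where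
  lower : ∀ s t, μ.real (Set.Iio s ×ˢ Set.Iio t) - ν.real (Set.Iic s ×ˢ Set.Iic t) ≤ f (s, t)
  upper : ∀ s t, f (s, t) ≤ μ.real (Set.Iic s ×ˢ Set.Iic t) - ν.real (Set.Iio s ×ˢ Set.Iio t)

/-- The half-lines `(-∞, s]` and `(-∞, s)` both converge pointwise to `A` along `l`. -/
def CutTendsto (l : Filter ℝ) (A : Set ℝ) : Prop :=
  ∀ u, ∀ᶠ s in l, (u ≤ s ↔ u ∈ A) ∧ (u < s ↔ u ∈ A)

theorem cutTendsto_nhdsGT (x : ℝ) : CutTendsto (𝓝[>] x) (Set.Iic x) := by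
  intro u
  rcases le_or_gt u x with h | h
  · filter_upwards [self_mem_nhdsWithin] with s hs
    have : u < s := h.trans_lt hs
    simp [h, this, this.le]
  · filter_upwards [nhdsWithin_le_nhds (Iio_mem_nhds h)] with s hs
    have hs : s < u := hs
    simp [not_le.2 h, not_le.2 hs, hs.le]

theorem cutTendsto_nhdsLT (x : ℝ) : CutTendsto (𝓝[<] x) (Set.Iio x) := by
  intro u
  rcases lt_or_ge u x with h | h
  · filter_upwards [nhdsWithin_le_nhds (Ioi_mem_nhds h)] with s hs
    have hs : u < s := hs
    simp [h, hs, hs.le]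
  · filter_upwards [self_mem_nhdsWithin] with s hs
    have hs : s < u := lt_of_lt_of_le hs h
    simp [not_lt.2 h, not_le.2 hs, hs.le]

theorem cutTendsto_atTop : CutTendsto atTop Set.univ := by
  intro u
  filter_upwards [eventually_gt_atTop u] with s hs
  simp [hs, hs.le]

section

variable {l l' : Filter ℝ} {A A' : Set ℝ}

theorem tendsto_real_Iic_prod (ρ : Measure (ℝ × ℝ)) [IsFiniteMeasure ρ]
    [l.IsCountablyGenerated] [l'.IsCountablyGenerated] (hA : MeasurableSet A)
    (hA' : MeasurableSet A') (h : CutTendsto l A) (h' : CutTendsto l' A') :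
    Tendsto (fun p : ℝ × ℝ => ρ.real (Set.Iic p.1 ×ˢ Set.Iic p.2)) (l ×ˢ l')
      (𝓝 (ρ.real (A ×ˢ A'))) := by
  refine (ENNReal.tendsto_toReal (measure_ne_top _ _)).comp
    (tendsto_measure_of_ae_tendsto_indicator_of_isFiniteMeasure _ (hA.prod hA')
      (fun p => measurableSet_Iic.prod measurableSet_Iic) (Eventually.of_forall fun q => ?_))
  filter_upwards [(h q.1).prod_mk (h' q.2)] with p hp
  rw [Set.mem_prod, Set.mem_prod, Set.mem_Iic, Set.mem_Iic, hp.1.1, hp.2.1]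

theorem tendsto_real_Iio_prod (ρ : Measure (ℝ × ℝ)) [IsFiniteMeasure ρ]
    [l.IsCountablyGenerated] [l'.IsCountablyGenerated] (hA : MeasurableSet A)
    (hA' : MeasurableSet A') (h : CutTendsto l A) (h' : CutTendsto l' A') :
    Tendsto (fun p : ℝ × ℝ => ρ.real (Set.Iio p.1 ×ˢ Set.Iio p.2)) (l ×ˢ l')
      (𝓝 (ρ.real (A ×ˢ A'))) := by
  refine (ENNReal.tendsto_toReal (measure_ne_top _ _)).comp
    (tendsto_measure_of_ae_tendsto_indicator_of_isFiniteMeasure _ (hA.prod hA')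
      (fun p => measurableSet_Iio.prod measurableSet_Iio) (Eventually.of_forall fun q => ?_))
  filter_upwards [(h q.1).prod_mk (h' q.2)] with p hp
  rw [Set.mem_prod, Set.mem_prod, Set.mem_Iio, Set.mem_Iio, hp.1.2, hp.2.2]

variable {μ ν : Measure (ℝ × ℝ)} [IsFiniteMeasure μ] [IsFiniteMeasure ν] {f : ℝ × ℝ → ℝ}

/-- Open and closed quadrants have the same limit along a cut, so the sandwich closes. With `A =
univ` this also covers limits at infinity. -/
theorem Represents.tendsto (hr : Represents μ ν f)
    [l.IsCountablyGenerated] [l'.IsCountablyGenerated] (hA : MeasurableSet A)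
    (hA' : MeasurableSet A') (h : CutTendsto l A) (h' : CutTendsto l' A') :
    Tendsto f (l ×ˢ l') (𝓝 (μ.real (A ×ˢ A') - ν.real (A ×ˢ A'))) :=
  tendsto_of_tendsto_of_tendsto_of_le_of_le
    ((tendsto_real_Iio_prod μ hA hA' h h').sub (tendsto_real_Iic_prod ν hA hA' h h'))
    ((tendsto_real_Iic_prod μ hA hA' h h').sub (tendsto_real_Iio_prod ν hA hA' h h'))
    (fun p => hr.lower p.1 p.2) (fun p => hr.upper p.1 p.2)

/-- As `s ↓ x` and `t → ∞`, `f (s, t)` tends to the difference of the marginals on `(-∞, x]`, and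
also to 0. -/
theorem Represents.map_fst_eq (hr : Represents μ ν f) (hf : MemBVVanishing f) :
    μ.map Prod.fst = ν.map Prod.fst := by
  refine Measure.ext_of_Iic _ _ fun x => ?_
  have h1 := hr.tendsto measurableSet_Iic MeasurableSet.univ (cutTendsto_nhdsGT x) cutTendsto_atTop
  have h2 : Tendsto f (𝓝[>] x ×ˢ atTop) (𝓝 0) := by
    refine hf.vanishing.comp (tendsto_comap_iff.2 ?_)
    exact tendsto_atTop_mono (fun p => (le_abs_self p.2).trans (norm_snd_le p)) tendsto_snd
  have h3 := sub_eq_zero.1 (tendsto_nhds_unique h1 h2)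
  rw [Measure.map_apply measurable_fst measurableSet_Iic,
    Measure.map_apply measurable_fst measurableSet_Iic, ← Set.prod_univ]
  exact (measureReal_eq_measureReal_iff).1 h3

theorem Represents.map_snd_eq (hr : Represents μ ν f) (hf : MemBVVanishing f) :
    μ.map Prod.snd = ν.map Prod.snd := by
  refine Measure.ext_of_Iic _ _ fun x => ?_
  have h1 := hr.tendsto MeasurableSet.univ measurableSet_Iic cutTendsto_atTop (cutTendsto_nhdsGT x)
  have h2 : Tendsto f (atTop ×ˢ 𝓝[>] x) (𝓝 0) := by
    refine hf.vanishing.comp (tendsto_comap_iff.2 ?_)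
    exact tendsto_atTop_mono (fun p => (le_abs_self p.1).trans (norm_fst_le p)) tendsto_fst
  have h3 := sub_eq_zero.1 (tendsto_nhds_unique h1 h2)
  rw [Measure.map_apply measurable_snd measurableSet_Iic,
    Measure.map_apply measurable_snd measurableSet_Iic, ← Set.univ_prod]
  exact (measureReal_eq_measureReal_iff).1 h3

end

/-- A finite measure charges at most countably many of the disjoint fibers. Open and closed
quadrants therefore differ in mass only for a null set of corners, and there alone the sandwich can
be strict. -/
theorem ae_measure_fiber_eq_zero (ρ : Measure (ℝ × ℝ)) [IsFiniteMeasure ρ] {g : ℝ × ℝ → ℝ}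
    (hg : Measurable g) : ∀ᵐ s : ℝ, ρ (g ⁻¹' {s}) = 0 := by
  have hc := Measure.countable_meas_pos_of_disjoint_iUnion (μ := ρ) (As := fun s => g ⁻¹' {s})
    (fun s => hg (measurableSet_singleton s))
    (fun s t hst => Disjoint.preimage g (Set.disjoint_singleton.2 hst))
  filter_upwards [hc.ae_notMem volume] with s hs
  simpa using hs

theorem ae_real_Iio_prod_eq (ρ : Measure (ℝ × ℝ)) [IsFiniteMeasure ρ] :
    ∀ᵐ p : ℝ × ℝ, ρ.real (Set.Iio p.1 ×ˢ Set.Iio p.2) = ρ.real (Set.Iic p.1 ×ˢ Set.Iic p.2) := by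
  have h1 := Measure.quasiMeasurePreserving_fst (μ := (volume : Measure ℝ))
    (ν := (volume : Measure ℝ)) |>.ae (ae_measure_fiber_eq_zero ρ measurable_fst)
  have h2 := Measure.quasiMeasurePreserving_snd (μ := (volume : Measure ℝ))
    (ν := (volume : Measure ℝ)) |>.ae (ae_measure_fiber_eq_zero ρ measurable_snd)
  filter_upwards [h1, h2] with p hp1 hp2
  refine measureReal_congr ?_
  have h3 : ∀ᵐ q ∂ρ, q.1 ≠ p.1 := measure_eq_zero_iff_ae_notMem.1 hp1
  have h4 : ∀ᵐ q ∂ρ, q.2 ≠ p.2 := measure_eq_zero_iff_ae_notMem.1 hp2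
  filter_upwards [h3, h4] with q hq1 hq2
  apply propext
  change q ∈ Set.Iio p.1 ×ˢ Set.Iio p.2 ↔ q ∈ Set.Iic p.1 ×ˢ Set.Iic p.2
  rw [Set.mem_prod, Set.mem_prod, Set.mem_Iio, Set.mem_Iio, Set.mem_Iic, Set.mem_Iic,
    lt_iff_le_and_ne, lt_iff_le_and_ne, and_iff_left hq1, and_iff_left hq2]

theorem measurable_real_Iic_prod (ρ : Measure (ℝ × ℝ)) [IsFiniteMeasure ρ] :
    Measurable fun p : ℝ × ℝ => ρ.real (Set.Iic p.1 ×ˢ Set.Iic p.2) := by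
  have hS : MeasurableSet {z : (ℝ × ℝ) × (ℝ × ℝ) | z.2.1 ≤ z.1.1 ∧ z.2.2 ≤ z.1.2} :=
    MeasurableSet.inter
      (measurableSet_le (measurable_fst.comp measurable_snd) (measurable_fst.comp measurable_fst))
      (measurableSet_le (measurable_snd.comp measurable_snd) (measurable_snd.comp measurable_fst))
  exact (measurable_measure_prodMk_left hS).ennreal_toReal

theorem Represents.ae_eq {μ ν : Measure (ℝ × ℝ)} [IsFiniteMeasure μ] [IsFiniteMeasure ν]
    {f : ℝ × ℝ → ℝ} (hr : Represents μ ν f) :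
    f =ᵐ[volume] fun p => μ.real (Set.Iic p.1 ×ˢ Set.Iic p.2)
      - ν.real (Set.Iic p.1 ×ˢ Set.Iic p.2) := by
  filter_upwards [ae_real_Iio_prod_eq μ, ae_real_Iio_prod_eq ν] with p h1 h2
  have h3 := hr.lower p.1 p.2
  have h4 := hr.upper p.1 p.2
  rw [h1] at h3
  rw [h2] at h4
  exact le_antisymm h4 h3

/-! ### The Kurzweil–Henstock integral of a Lebesgue integrable function -/

theorem hasIntegral_rectBox {F : ℝ × ℝ → ℂ} {a b c d : ℝ} (hab : a < b) (hcd : c < d)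
    (hF : IntegrableOn F (Set.Ioc a b ×ˢ Set.Ioc c d)) :
    BoxIntegral.HasIntegral (rectBox a b c d hab hcd) BoxIntegral.IntegrationParams.Henstock
      (fun t : Fin 2 → ℝ => F (t 0, t 1)) BoxIntegral.BoxAdditiveMap.volume
      (∫ p in Set.Ioc a b ×ˢ Set.Ioc c d, F p) := by
  have hpre : ((rectBox a b c d hab hcd : BoxIntegral.Box (Fin 2)) : Set (Fin 2 → ℝ))
      = MeasurableEquiv.finTwoArrow ⁻¹' (Set.Ioc a b ×ˢ Set.Ioc c d) := by
    ext t
    simp [rectBox, BoxIntegral.Box.mem_def, Fin.forall_fin_two, MeasurableEquiv.finTwoArrow]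
  have hmp := volume_preserving_finTwoArrow ℝ
  have hint : IntegrableOn (fun t : Fin 2 → ℝ => F (t 0, t 1))
      (rectBox a b c d hab hcd : BoxIntegral.Box (Fin 2)) := by
    rw [hpre]
    exact (hmp.integrableOn_comp_preimage
      (MeasurableEquiv.finTwoArrow (α := ℝ)).measurableEmbedding).2 hF
  -- The `rfl` checks `bRiemann = false`: the gauge may depend on the tag, so Lebesgue integrability
  -- suffices.
  have h := hint.hasBoxIntegral BoxIntegral.IntegrationParams.Henstock rfl
  rw [hpre] at h
  have h' := hmp.setIntegral_preimage_emb
    (MeasurableEquiv.finTwoArrow (α := ℝ)).measurableEmbedding F (Set.Ioc a b ×ˢ Set.Ioc c d)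
  rw [← h']
  exact h

theorem khIntegral_eq {F : ℝ × ℝ → ℂ} {a b c d : ℝ} (hab : a < b) (hcd : c < d)
    (hF : IntegrableOn F (Set.Ioc a b ×ˢ Set.Ioc c d)) :
    khIntegral F a b c d = ∫ p in Set.Ioc a b ×ˢ Set.Ioc c d, F p := by
  rw [khIntegral, dif_pos ⟨hab, hcd⟩]
  exact (hasIntegral_rectBox hab hcd hF).integral_eq

/-! ### The Fourier transform of a represented function -/

/-- The one-dimensional Fourier kernel `e^{-iξs}`. -/
noncomputable def fourierKernel (ξ s : ℝ) : ℂ := Complex.exp (-(Complex.I * ((ξ * s : ℝ) : ℂ)))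

theorem fourierKernel_eq (ξ s : ℝ) :
    fourierKernel ξ s = Complex.exp (((-(ξ * s) : ℝ) : ℂ) * Complex.I) := by
  rw [fourierKernel]
  congr 1
  push_cast
  ring

@[simp] theorem norm_fourierKernel (ξ s : ℝ) : ‖fourierKernel ξ s‖ = 1 := by
  rw [fourierKernel_eq, Complex.norm_exp_ofReal_mul_I]

theorem continuous_fourierKernel (ξ : ℝ) : Continuous (fourierKernel ξ) := by
  unfold fourierKernel
  fun_prop

theorem fourierIntegrand_eq (f : ℝ × ℝ → ℝ) (ξ η : ℝ) (t : ℝ × ℝ) :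
    fourierIntegrand f ξ η t = (f t : ℂ) * (fourierKernel ξ t.1 * fourierKernel η t.2) := by
  rw [fourierIntegrand, fourierKernel, fourierKernel, ← Complex.exp_add]
  congr 2
  push_cast
  ring

theorem integral_fst_eq {μ ν : Measure (ℝ × ℝ)} (h : μ.map Prod.fst = ν.map Prod.fst)
    {E : Type*} [NormedAddCommGroup E] [NormedSpace ℝ E] [SecondCountableTopology E]
    [MeasurableSpace E] [BorelSpace E] {g : ℝ → E} (hg : Measurable g) :
    ∫ q, g q.1 ∂μ = ∫ q, g q.1 ∂ν := by
  rw [← integral_map (φ := Prod.fst) (by fun_prop) hg.aestronglyMeasurable, h,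
    integral_map (φ := Prod.fst) (by fun_prop) hg.aestronglyMeasurable]

theorem integral_snd_eq {μ ν : Measure (ℝ × ℝ)} (h : μ.map Prod.snd = ν.map Prod.snd)
    {E : Type*} [NormedAddCommGroup E] [NormedSpace ℝ E] [SecondCountableTopology E]
    [MeasurableSpace E] [BorelSpace E] {g : ℝ → E} (hg : Measurable g) :
    ∫ q, g q.2 ∂μ = ∫ q, g q.2 ∂ν := by
  rw [← integral_map (φ := Prod.snd) (by fun_prop) hg.aestronglyMeasurable, h,
    integral_map (φ := Prod.snd) (by fun_prop) hg.aestronglyMeasurable]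

theorem integral_sub_const_mul_sub_const {𝕜 : Type*} [RCLike 𝕜] (ρ : Measure (ℝ × ℝ))
    [IsFiniteMeasure ρ] {g h : ℝ → 𝕜} (hg : Measurable g) (hh : Measurable h) {C D : ℝ}
    (hgC : ∀ u, ‖g u‖ ≤ C) (hhD : ∀ u, ‖h u‖ ≤ D) (c d : 𝕜) :
    ∫ q, (g q.1 - c) * (h q.2 - d) ∂ρ = ∫ q, g q.1 * h q.2 ∂ρ - (∫ q, g q.1 ∂ρ) * d
      - c * (∫ q, h q.2 ∂ρ) + ∫ _, c * d ∂ρ := by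
  have ig : Integrable (fun q : ℝ × ℝ => g q.1) ρ :=
    Integrable.of_bound (hg.comp measurable_fst).aestronglyMeasurable C
      (Eventually.of_forall fun q => hgC _)
  have ih : Integrable (fun q : ℝ × ℝ => h q.2) ρ :=
    Integrable.of_bound (hh.comp measurable_snd).aestronglyMeasurable D
      (Eventually.of_forall fun q => hhD _)
  have igh : Integrable (fun q : ℝ × ℝ => g q.1 * h q.2) ρ :=
    Integrable.of_bound ((hg.comp measurable_fst).mul (hh.comp measurable_snd)).aestronglyMeasurable
      (C * D) (Eventually.of_forall fun q => by
        rw [norm_mul]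
        exact mul_le_mul (hgC _) (hhD _) (norm_nonneg _) ((norm_nonneg _).trans (hgC 0)))
  have i1 : Integrable (fun q : ℝ × ℝ => g q.1 * h q.2 - g q.1 * d) ρ := igh.sub (ig.mul_const d)
  have i2 : Integrable (fun q : ℝ × ℝ => g q.1 * h q.2 - g q.1 * d - c * h q.2) ρ :=
    i1.sub (ih.const_mul c)
  rw [← integral_mul_const, ← integral_const_mul, ← integral_sub igh (ig.mul_const d),
    ← integral_sub i1 (ih.const_mul c), ← integral_add i2 (integrable_const _)]
  refine integral_congr_ae (Eventually.of_forall fun q => ?_)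
  simp only
  ring

/-- For measures with equal marginals, the difference of the integrals of a product does not see
constants added to the factors. -/
theorem integral_sub_integral_eq_of_marginals {𝕜 : Type*} [RCLike 𝕜] {μ ν : Measure (ℝ × ℝ)}
    [IsFiniteMeasure μ] [IsFiniteMeasure ν] (h1 : μ.map Prod.fst = ν.map Prod.fst)
    (h2 : μ.map Prod.snd = ν.map Prod.snd) {g h : ℝ → 𝕜} (hg : Measurable g) (hh : Measurable h)
    {C D : ℝ} (hgC : ∀ u, ‖g u‖ ≤ C) (hhD : ∀ u, ‖h u‖ ≤ D) (c d : 𝕜) :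
    ∫ q, (g q.1 - c) * (h q.2 - d) ∂μ - ∫ q, (g q.1 - c) * (h q.2 - d) ∂ν
      = ∫ q, g q.1 * h q.2 ∂μ - ∫ q, g q.1 * h q.2 ∂ν := by
  rw [integral_sub_const_mul_sub_const μ hg hh hgC hhD,
    integral_sub_const_mul_sub_const ν hg hh hgC hhD, integral_fst_eq h1 hg, integral_snd_eq h2 hh,
    integral_fst_eq h1 (measurable_const (a := c * d))]
  ring

/-! ### The rectangle integrals by Fubini -/

/-- The integral of `e^{-iξs}` over the part of `(a, b]` to the right of `u`. -/
noncomputable def cutIntegral (ξ a b u : ℝ) : ℂ :=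
  ∫ s in Set.Ioc a b, (Set.Ici u).indicator (fourierKernel ξ) s

/-- Projection of the line onto `[a, b]`. -/
noncomputable def clamp (a b u : ℝ) : ℝ := max a (min u b)

/-- The part of `(a, b]` to the right of `u` starts at `clamp a b u`, and is empty when `u ≥ b`. The
term at `b` does not depend on `u`, so equal marginals will remove it. -/
theorem cutIntegral_eq {ξ : ℝ} (hξ : ξ ≠ 0) {a b : ℝ} (hab : a ≤ b) (u : ℝ) :
    cutIntegral ξ a b u =
      (Complex.I * ξ)⁻¹ * (fourierKernel ξ (clamp a b u) - fourierKernel ξ b) := by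
  have hset : Set.Ioc a b ∩ Set.Ioi u = Set.Ioc (clamp a b u) b := by
    ext s
    simp only [clamp, Set.mem_inter_iff, Set.mem_Ioc, Set.mem_Ioi, sup_lt_iff, inf_lt_iff]
    constructor
    · rintro ⟨⟨h1, h2⟩, h3⟩
      exact ⟨⟨h1, Or.inl h3⟩, h2⟩
    · rintro ⟨⟨h1, h2 | h2⟩, h3⟩
      · exact ⟨⟨h1, h3⟩, h2⟩
      · exact absurd h2 (not_lt.2 h3)
  have hcb : clamp a b u ≤ b := max_le hab (min_le_right _ _)
  have hc : -(Complex.I * ξ) ≠ 0 :=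
    neg_ne_zero.2 (mul_ne_zero Complex.I_ne_zero (by exact_mod_cast hξ))
  rw [cutIntegral, setIntegral_indicator measurableSet_Ici,
    setIntegral_congr_set ((ae_eq_refl _).inter Ioi_ae_eq_Ici.symm), hset,
    ← intervalIntegral.integral_of_le hcb]
  have : ∀ s : ℝ, fourierKernel ξ s = Complex.exp (-(Complex.I * ξ) * s) := by
    intro s
    rw [fourierKernel]
    congr 1
    push_cast
    ring
  simp only [this]
  rw [integral_exp_mul_complex hc]
  field_simp
  ring

theorem integral_real_Iic_prod_mul (ρ : Measure (ℝ × ℝ)) [IsFiniteMeasure ρ] (ξ η a b c d : ℝ) :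
    ∫ p in Set.Ioc a b ×ˢ Set.Ioc c d, (ρ.real (Set.Iic p.1 ×ˢ Set.Iic p.2) : ℂ) *
        (fourierKernel ξ p.1 * fourierKernel η p.2)
      = ∫ q, cutIntegral ξ a b q.1 * cutIntegral η c d q.2 ∂ρ := by
  let Φ : (ℝ × ℝ) → (ℝ × ℝ) → ℂ := fun p q =>
    (Set.Ici q.1).indicator (fourierKernel ξ) p.1 * (Set.Ici q.2).indicator (fourierKernel η) p.2
  have hm : Measurable (Function.uncurry Φ) := by
    have h1 : MeasurableSet {z : (ℝ × ℝ) × (ℝ × ℝ) | z.2.1 ≤ z.1.1} :=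
      measurableSet_le (measurable_fst.comp measurable_snd) (measurable_fst.comp measurable_fst)
    have h2 : MeasurableSet {z : (ℝ × ℝ) × (ℝ × ℝ) | z.2.2 ≤ z.1.2} :=
      measurableSet_le (measurable_snd.comp measurable_snd) (measurable_snd.comp measurable_fst)
    exact (((continuous_fourierKernel ξ).measurable.comp
        (measurable_fst.comp measurable_fst)).indicator h1).mul
      (((continuous_fourierKernel η).measurable.comp
        (measurable_snd.comp measurable_fst)).indicator h2)
  have hb : ∀ (ζ u s : ℝ), ‖(Set.Ici u).indicator (fourierKernel ζ) s‖ ≤ 1 := fun ζ u s =>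
    (norm_indicator_le_norm_self _ _).trans (norm_fourierKernel ζ s).le
  have hfin : IsFiniteMeasure ((volume : Measure (ℝ × ℝ)).restrict
      (Set.Ioc a b ×ˢ Set.Ioc c d)) := by
    refine isFiniteMeasure_restrict.2 ?_
    rw [Measure.volume_eq_prod, Measure.prod_prod]
    simp [ENNReal.mul_ne_top]
  have hi : Integrable (Function.uncurry Φ)
      ((volume.restrict (Set.Ioc a b ×ˢ Set.Ioc c d)).prod ρ) :=
    Integrable.of_bound hm.aestronglyMeasurable 1 (Eventually.of_forall fun z => by
      simp only [Function.uncurry, Φ, norm_mul]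
      exact mul_le_one₀ (hb _ _ _) (norm_nonneg _) (hb _ _ _))
  calc
    _ = ∫ p in Set.Ioc a b ×ˢ Set.Ioc c d, ∫ q, Φ p q ∂ρ := by
      refine integral_congr_ae (Eventually.of_forall fun p => ?_)
      have : Φ p = (Set.Iic p.1 ×ˢ Set.Iic p.2).indicator
          fun _ => fourierKernel ξ p.1 * fourierKernel η p.2 := by
        ext q
        by_cases h1 : q.1 ≤ p.1 <;> by_cases h2 : q.2 ≤ p.2 <;>
          simp [Φ, Set.indicator, h1, h2, Prod.le_def]
      simp only [this]
      rw [integral_indicator_const _ (measurableSet_Iic.prod measurableSet_Iic), Complex.real_smul]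
    _ = ∫ q, (∫ p in Set.Ioc a b ×ˢ Set.Ioc c d, Φ p q) ∂ρ := integral_integral_swap hi
    _ = _ := by
      refine integral_congr_ae (Eventually.of_forall fun q => ?_)
      simp only [Φ, cutIntegral]
      rw [Measure.volume_eq_prod, setIntegral_prod_mul]

theorem integrableOn_real_Iic_prod_mul (ρ : Measure (ℝ × ℝ)) [IsFiniteMeasure ρ] (ξ η a b c d : ℝ) :
    IntegrableOn (fun p : ℝ × ℝ => (ρ.real (Set.Iic p.1 ×ˢ Set.Iic p.2) : ℂ) *
      (fourierKernel ξ p.1 * fourierKernel η p.2)) (Set.Ioc a b ×ˢ Set.Ioc c d) := by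
  refine IntegrableOn.of_bound ?_ (Measurable.aestronglyMeasurable ?_) (ρ.real Set.univ)
    (Eventually.of_forall fun p => ?_)
  · rw [Measure.volume_eq_prod, Measure.prod_prod]
    simp [ENNReal.mul_lt_top]
  · exact (Complex.measurable_ofReal.comp (measurable_real_Iic_prod ρ)).mul
      (((continuous_fourierKernel ξ).measurable.comp measurable_fst).mul
        ((continuous_fourierKernel η).measurable.comp measurable_snd))
  · simp only [norm_mul, norm_fourierKernel, mul_one, Complex.norm_real, Real.norm_eq_abs,
      abs_of_nonneg measureReal_nonneg]
    exact measureReal_mono (Set.subset_univ _)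

section

variable {μ ν : Measure (ℝ × ℝ)} [IsFiniteMeasure μ] [IsFiniteMeasure ν] {f : ℝ × ℝ → ℝ}

theorem Represents.fourierIntegrand_ae_eq (hr : Represents μ ν f) (ξ η : ℝ) :
    fourierIntegrand f ξ η =ᵐ[volume] fun p =>
      (μ.real (Set.Iic p.1 ×ˢ Set.Iic p.2) : ℂ) * (fourierKernel ξ p.1 * fourierKernel η p.2)
      - (ν.real (Set.Iic p.1 ×ˢ Set.Iic p.2) : ℂ) *
        (fourierKernel ξ p.1 * fourierKernel η p.2) := by
  filter_upwards [hr.ae_eq] with p hp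
  rw [fourierIntegrand_eq, hp]
  push_cast
  ring

theorem Represents.integrableOn_fourierIntegrand (hr : Represents μ ν f) (ξ η a b c d : ℝ) :
    IntegrableOn (fourierIntegrand f ξ η) (Set.Ioc a b ×ˢ Set.Ioc c d) :=
  ((integrableOn_real_Iic_prod_mul μ ξ η a b c d).sub
    (integrableOn_real_Iic_prod_mul ν ξ η a b c d)).congr
      (ae_restrict_of_ae (hr.fourierIntegrand_ae_eq ξ η).symm)

theorem measurable_fourierKernel_clamp (ξ a b : ℝ) :
    Measurable fun u => fourierKernel ξ (clamp a b u) :=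
  (continuous_fourierKernel ξ).measurable.comp (by unfold clamp; fun_prop)

/-- The equal marginals cancel the terms at `b` and `d`, which oscillate and would obstruct the
limit `b, d → ∞`. -/
theorem Represents.khIntegral_eq (hr : Represents μ ν f) (hf : MemBVVanishing f) {ξ η : ℝ}
    (hξ : ξ ≠ 0) (hη : η ≠ 0) {a b c d : ℝ} (hab : a < b) (hcd : c < d) :
    khIntegral (fourierIntegrand f ξ η) a b c d = ((Complex.I * ξ) * (Complex.I * η))⁻¹ *
      (∫ q, fourierKernel ξ (clamp a b q.1) * fourierKernel η (clamp c d q.2) ∂μ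
        - ∫ q, fourierKernel ξ (clamp a b q.1) * fourierKernel η (clamp c d q.2) ∂ν) := by
  rw [KPFourier.khIntegral_eq hab hcd (hr.integrableOn_fourierIntegrand ξ η a b c d),
    integral_congr_ae (ae_restrict_of_ae (hr.fourierIntegrand_ae_eq ξ η)),
    integral_sub (integrableOn_real_Iic_prod_mul μ ξ η a b c d)
      (integrableOn_real_Iic_prod_mul ν ξ η a b c d),
    integral_real_Iic_prod_mul, integral_real_Iic_prod_mul,
    ← integral_sub_integral_eq_of_marginals (hr.map_fst_eq hf) (hr.map_snd_eq hf)
      (measurable_fourierKernel_clamp ξ a b) (measurable_fourierKernel_clamp η c d)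
      (fun u => (norm_fourierKernel _ _).le) (fun u => (norm_fourierKernel _ _).le)
      (fourierKernel ξ b) (fourierKernel η d), mul_sub,
    ← integral_const_mul, ← integral_const_mul]
  simp only [cutIntegral_eq hξ hab.le, cutIntegral_eq hη hcd.le]
  congr 1 <;>
  · congr 1
    ext q
    rw [mul_inv]
    ring

theorem eventually_clamp_eq (u : ℝ) :
    ∀ᶠ r : ℝ × ℝ in atBot ×ˢ atTop, clamp r.1 r.2 u = u := by
  filter_upwards [(eventually_le_atBot u).prod_mk (eventually_ge_atTop u)] with r hr
  simp [clamp, hr.1, hr.2]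

/-- For fixed `q` the clamps are eventually the identity, and the integrand has modulus 1. -/
theorem tendsto_integral_clamp (ρ : Measure (ℝ × ℝ)) [IsFiniteMeasure ρ] (ξ η : ℝ) :
    Tendsto (fun r : ℝ × ℝ × ℝ × ℝ => ∫ q, fourierKernel ξ (clamp r.1 r.2.1 q.1) *
      fourierKernel η (clamp r.2.2.1 r.2.2.2 q.2) ∂ρ) pringsheim
      (𝓝 (∫ q, fourierKernel ξ q.1 * fourierKernel η q.2 ∂ρ)) := by
  have : pringsheim.IsCountablyGenerated := by
    unfold pringsheim
    infer_instance
  refine tendsto_integral_filter_of_dominated_convergence (fun _ => 1) ?_ ?_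
    (integrable_const _) ?_
  · exact Eventually.of_forall fun r => Measurable.aestronglyMeasurable
      (((measurable_fourierKernel_clamp ξ _ _).comp measurable_fst).mul
        ((measurable_fourierKernel_clamp η _ _).comp measurable_snd))
  · exact Eventually.of_forall fun r => Eventually.of_forall fun q => by simp
  · refine Eventually.of_forall fun q => tendsto_const_nhds.congr' ?_
    have h1 : ∀ᶠ r : ℝ × ℝ × ℝ × ℝ in pringsheim, clamp r.1 r.2.1 q.1 = q.1 := by
      have : Tendsto (fun r : ℝ × ℝ × ℝ × ℝ => (r.1, r.2.1)) pringsheim (atBot ×ˢ atTop) :=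
        tendsto_fst.prodMk (tendsto_fst.comp tendsto_snd)
      exact this.eventually (eventually_clamp_eq q.1)
    have h2 : ∀ᶠ r : ℝ × ℝ × ℝ × ℝ in pringsheim, clamp r.2.2.1 r.2.2.2 q.2 = q.2 := by
      have : Tendsto (fun r : ℝ × ℝ × ℝ × ℝ => r.2.2) pringsheim (atBot ×ˢ atTop) :=
        tendsto_snd.comp tendsto_snd
      exact this.eventually (eventually_clamp_eq q.2)
    filter_upwards [h1, h2] with r hr1 hr2
    rw [hr1, hr2]

theorem Represents.hasKPFourierAt (hr : Represents μ ν f) (hf : MemBVVanishing f) {ξ η : ℝ}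
    (hξ : ξ ≠ 0) (hη : η ≠ 0) :
    HasKPFourierAt f ξ η (((Complex.I * ξ) * (Complex.I * η))⁻¹ *
      (∫ q, fourierKernel ξ q.1 * fourierKernel η q.2 ∂μ
        - ∫ q, fourierKernel ξ q.1 * fourierKernel η q.2 ∂ν)) := by
  refine ⟨fun a b c d hab hcd =>
    (hasIntegral_rectBox hab hcd (hr.integrableOn_fourierIntegrand ξ η a b c d)).integrable, ?_⟩
  refine (((tendsto_integral_clamp μ ξ η).sub (tendsto_integral_clamp ν ξ η)).const_mul _).congr' ?_
  have h1 : ∀ᶠ r : ℝ × ℝ × ℝ × ℝ in pringsheim, r.1 < r.2.1 := by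
    have : Tendsto (fun r : ℝ × ℝ × ℝ × ℝ => (r.1, r.2.1)) pringsheim (atBot ×ˢ atTop) :=
      tendsto_fst.prodMk (tendsto_fst.comp tendsto_snd)
    refine this.eventually (p := fun z => z.1 < z.2) ?_
    filter_upwards [(eventually_lt_atBot 0).prod_mk (eventually_gt_atTop 0)] with z hz
    exact hz.1.trans hz.2
  have h2 : ∀ᶠ r : ℝ × ℝ × ℝ × ℝ in pringsheim, r.2.2.1 < r.2.2.2 := by
    have : Tendsto (fun r : ℝ × ℝ × ℝ × ℝ => r.2.2) pringsheim (atBot ×ˢ atTop) :=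
      tendsto_snd.comp tendsto_snd
    refine this.eventually (p := fun z => z.1 < z.2) ?_
    filter_upwards [(eventually_lt_atBot 0).prod_mk (eventually_gt_atTop 0)] with z hz
    exact hz.1.trans hz.2
  filter_upwards [h1, h2] with r hr1 hr2
  exact (hr.khIntegral_eq hf hξ hη hr1 hr2).symm

theorem HasKPFourierAt.kpFourier_eq {ξ η : ℝ} {L : ℂ} (h : HasKPFourierAt f ξ η L) :
    kpFourier f ξ η = L := by
  have : pringsheim.NeBot := by
    unfold pringsheim
    infer_instance
  exact h.2.limUnder_eq

end

/-! ### The inversion integral -/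

/-- The one-dimensional inversion kernel `e^{iwξ} / (iξ)`. -/
noncomputable def inversionKernel (w ξ : ℝ) : ℂ :=
  Complex.exp (Complex.I * ((w * ξ : ℝ) : ℂ)) / (Complex.I * ξ)

/-- The integral of the inversion kernel over `α ≤ |ξ| ≤ β`. -/
noncomputable def inversionWeight (α β w : ℝ) : ℝ := 2 * (sinInt (w * β) - sinInt (w * α))

theorem norm_inversionKernel (w ξ : ℝ) : ‖inversionKernel w ξ‖ = |ξ|⁻¹ := by
  rw [inversionKernel, norm_div, mul_comm Complex.I, Complex.norm_exp_ofReal_mul_I]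
  simp

theorem measurable_inversionKernel : Measurable fun z : ℝ × ℝ => inversionKernel z.1 z.2 := by
  unfold inversionKernel
  fun_prop

theorem frequencyRegion_eq (α₁ α₂ β₁ β₂ : ℝ) :
    frequencyRegion α₁ α₂ β₁ β₂ = annulus α₁ β₁ ×ˢ annulus α₂ β₂ := rfl

theorem measurableSet_frequencyRegion (α₁ α₂ β₁ β₂ : ℝ) :
    MeasurableSet (frequencyRegion α₁ α₂ β₁ β₂) :=
  (measurableSet_annulus _ _).prod (measurableSet_annulus _ _)

theorem volume_annulus_lt_top (α β : ℝ) : volume (annulus α β) < ∞ :=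
  (measure_mono (fun _ hξ => abs_le.1 hξ.2 : annulus α β ⊆ Set.Icc (-β) β)).trans_lt
    measure_Icc_lt_top

theorem isFiniteMeasure_restrict_frequencyRegion (α₁ α₂ β₁ β₂ : ℝ) :
    IsFiniteMeasure ((volume : Measure (ℝ × ℝ)).restrict (frequencyRegion α₁ α₂ β₁ β₂)) := by
  refine isFiniteMeasure_restrict.2 ?_
  rw [frequencyRegion_eq, Measure.volume_eq_prod, Measure.prod_prod]
  exact ENNReal.mul_ne_top (volume_annulus_lt_top _ _).ne (volume_annulus_lt_top _ _).ne

section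

variable (ρ : Measure (ℝ × ℝ)) [IsFiniteMeasure ρ] (x y : ℝ) {α₁ α₂ β₁ β₂ : ℝ}

theorem integrable_inversionKernel_mul (h1 : 0 < α₁) (h2 : 0 < α₂) :
    Integrable (Function.uncurry fun p q : ℝ × ℝ =>
        inversionKernel (x - q.1) p.1 * inversionKernel (y - q.2) p.2)
      ((volume.restrict (frequencyRegion α₁ α₂ β₁ β₂)).prod ρ) := by
  have := isFiniteMeasure_restrict_frequencyRegion α₁ α₂ β₁ β₂
  have hm : Measurable (Function.uncurry fun p q : ℝ × ℝ =>
      inversionKernel (x - q.1) p.1 * inversionKernel (y - q.2) p.2) :=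
    (measurable_inversionKernel.comp ((measurable_const.sub (measurable_fst.comp measurable_snd)).prodMk
      (measurable_fst.comp measurable_fst))).mul
    (measurable_inversionKernel.comp ((measurable_const.sub (measurable_snd.comp measurable_snd)).prodMk
      (measurable_snd.comp measurable_fst)))
  refine Integrable.of_bound hm.aestronglyMeasurable (α₁⁻¹ * α₂⁻¹) ?_
  have hae : ∀ᵐ z : (ℝ × ℝ) × (ℝ × ℝ) ∂(volume.restrict (frequencyRegion α₁ α₂ β₁ β₂)).prod ρ,
      z.1 ∈ frequencyRegion α₁ α₂ β₁ β₂ :=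
    Measure.quasiMeasurePreserving_fst.ae
      (ae_restrict_mem (measurableSet_frequencyRegion α₁ α₂ β₁ β₂))
  filter_upwards [hae] with z hz
  simp only [Function.uncurry, norm_mul, norm_inversionKernel]
  have := hz.1.1
  have := hz.2.1
  gcongr

theorem integral_inversionKernel_mul (h1 : 0 < α₁) (h1' : α₁ < β₁) (h2 : 0 < α₂) (h2' : α₂ < β₂) :
    ∫ p in frequencyRegion α₁ α₂ β₁ β₂,
        (∫ q, inversionKernel (x - q.1) p.1 * inversionKernel (y - q.2) p.2 ∂ρ)
      = ((∫ q, inversionWeight α₁ β₁ (x - q.1) * inversionWeight α₂ β₂ (y - q.2) ∂ρ : ℝ) : ℂ) := by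
  rw [integral_integral_swap (integrable_inversionKernel_mul ρ x y h1 h2), ← integral_complex_ofReal]
  refine integral_congr_ae (Eventually.of_forall fun q => ?_)
  simp only [Complex.ofReal_mul]
  rw [frequencyRegion_eq, Measure.volume_eq_prod, setIntegral_prod_mul]
  exact congrArg₂ _ (integral_annulus h1 h1' _) (integral_annulus h2 h2' _)

theorem tendsto_inversionWeight (w : ℝ) :
    Tendsto (fun r : ℝ × ℝ => inversionWeight r.1 r.2 w) (𝓝[>] 0 ×ˢ atTop)
      (𝓝 (Real.pi * SignType.sign w)) := by
  have h1 : Tendsto (fun α => sinInt (w * α)) (𝓝[>] 0) (𝓝 0) := by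
    have : Continuous fun α => sinInt (w * α) :=
      continuous_sinInt.comp (continuous_const.mul continuous_id)
    simpa using (this.tendsto 0).mono_left nhdsWithin_le_nhds
  have h := (((tendsto_sinInt_mul_atTop w).comp
    (tendsto_snd (f := 𝓝[>] (0 : ℝ)))).sub (h1.comp (tendsto_fst (g := atTop)))).const_mul 2
  exact h.trans (le_of_eq (congrArg 𝓝 (by ring)))

theorem measurable_inversionWeight (α β : ℝ) : Measurable (inversionWeight α β) := by
  unfold inversionWeight
  exact (((continuous_sinInt.comp (continuous_id.mul continuous_const)).sub
    (continuous_sinInt.comp (continuous_id.mul continuous_const))).const_mul 2).measurable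

/-- The bound on `sinInt` is uniform in all four frequencies, so dominated convergence applies
however independently they move. -/
theorem tendsto_integral_inversionWeight :
    Tendsto (fun r : (ℝ × ℝ) × (ℝ × ℝ) => ∫ q, inversionWeight r.1.1 r.2.1 (x - q.1) *
        inversionWeight r.1.2 r.2.2 (y - q.2) ∂ρ)
      ((𝓝[>] (0 : ℝ) ×ˢ 𝓝[>] (0 : ℝ)) ×ˢ (atTop ×ˢ atTop))
      (𝓝 (∫ q, (Real.pi * SignType.sign (x - q.1)) * (Real.pi * SignType.sign (y - q.2)) ∂ρ)) := by
  obtain ⟨C, hC⟩ := exists_abs_sinInt_le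
  have hW : ∀ α β w, ‖inversionWeight α β w‖ ≤ 2 * (C + C) := by
    intro α β w
    rw [inversionWeight, norm_mul, Real.norm_ofNat]
    gcongr
    exact (norm_sub_le _ _).trans (add_le_add (hC _) (hC _))
  refine tendsto_integral_filter_of_dominated_convergence
    (fun _ => 2 * (C + C) * (2 * (C + C))) ?_ ?_ (integrable_const _) ?_
  · exact Eventually.of_forall fun r => Measurable.aestronglyMeasurable
      (((measurable_inversionWeight _ _).comp (measurable_const.sub measurable_fst)).mul
        ((measurable_inversionWeight _ _).comp (measurable_const.sub measurable_snd)))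
  · refine Eventually.of_forall fun r => Eventually.of_forall fun q => ?_
    rw [norm_mul]
    exact mul_le_mul (hW _ _ _) (hW _ _ _) (norm_nonneg _) ((norm_nonneg _).trans (hW 0 0 0))
  · have h1 : Tendsto (fun r : (ℝ × ℝ) × (ℝ × ℝ) => (r.1.1, r.2.1))
        ((𝓝[>] (0 : ℝ) ×ˢ 𝓝[>] (0 : ℝ)) ×ˢ (atTop ×ˢ atTop)) (𝓝[>] 0 ×ˢ atTop) :=
      (tendsto_fst.comp tendsto_fst).prodMk (tendsto_fst.comp tendsto_snd)
    have h2 : Tendsto (fun r : (ℝ × ℝ) × (ℝ × ℝ) => (r.1.2, r.2.2))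
        ((𝓝[>] (0 : ℝ) ×ˢ 𝓝[>] (0 : ℝ)) ×ˢ (atTop ×ˢ atTop)) (𝓝[>] 0 ×ˢ atTop) :=
      (tendsto_snd.comp tendsto_fst).prodMk (tendsto_snd.comp tendsto_snd)
    refine Eventually.of_forall fun q => ?_
    have h3 := (tendsto_inversionWeight (x - q.1)).comp h1
    have h4 := (tendsto_inversionWeight (y - q.2)).comp h2
    simp only [Function.comp_def] at h3 h4
    exact h3.mul h4

/-! ### From signs to the four quadrants -/

/-- The sum of the indicator functions of `(-∞, x)` and `(-∞, x]`. -/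
noncomputable def cutSum (x u : ℝ) : ℝ :=
  (Set.Iio x).indicator (fun _ => 1) u + (Set.Iic x).indicator (fun _ => 1) u

theorem measurable_cutSum : Measurable (cutSum x) :=
  (measurable_const.indicator measurableSet_Iio).add (measurable_const.indicator measurableSet_Iic)

theorem norm_cutSum_le (u : ℝ) : ‖cutSum x u‖ ≤ 1 + 1 := by
  refine (norm_add_le _ _).trans (add_le_add ?_ ?_) <;>
  · refine (norm_indicator_le_norm_self _ _).trans ?_
    simp

theorem sign_sub_eq (u : ℝ) : (SignType.sign (x - u) : ℝ) = cutSum x u - 1 := by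
  rcases lt_trichotomy u x with h | rfl | h
  · simp [cutSum, sign_pos (sub_pos.2 h), h, h.le]
  · simp [cutSum]
  · simp [cutSum, sign_neg (sub_neg.2 h), not_lt.2 h.le, not_le.2 h]

theorem integral_cutSum_mul :
    ∫ q, cutSum x q.1 * cutSum y q.2 ∂ρ =
      ρ.real (Set.Iic x ×ˢ Set.Iic y) + ρ.real (Set.Iic x ×ˢ Set.Iio y)
      + ρ.real (Set.Iio x ×ˢ Set.Iic y) + ρ.real (Set.Iio x ×ˢ Set.Iio y) := by
  have hm : ∀ {A B : Set ℝ}, MeasurableSet A → MeasurableSet B →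
      Integrable ((A ×ˢ B).indicator fun _ : ℝ × ℝ => (1 : ℝ)) ρ := fun hA hB =>
    (integrable_const 1).indicator (hA.prod hB)
  have hI : ∀ {A B : Set ℝ}, MeasurableSet A → MeasurableSet B →
      ∫ q, (A ×ˢ B).indicator (fun _ : ℝ × ℝ => (1 : ℝ)) q ∂ρ = ρ.real (A ×ˢ B) := by
    intro A B hA hB
    rw [integral_indicator_const _ (hA.prod hB), smul_eq_mul, mul_one]
  have i1 := hm (measurableSet_Iic (a := x)) (measurableSet_Iic (a := y))
  have i2 := hm (measurableSet_Iic (a := x)) (measurableSet_Iio (a := y))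
  have i3 := hm (measurableSet_Iio (a := x)) (measurableSet_Iic (a := y))
  have i4 := hm (measurableSet_Iio (a := x)) (measurableSet_Iio (a := y))
  rw [← hI measurableSet_Iic measurableSet_Iic, ← hI measurableSet_Iic measurableSet_Iio,
    ← hI measurableSet_Iio measurableSet_Iic, ← hI measurableSet_Iio measurableSet_Iio,
    ← integral_add i1 i2, ← integral_add (by exact i1.add i2) i3,
    ← integral_add (by exact (i1.add i2).add i3) i4]
  refine integral_congr_ae (Eventually.of_forall fun q => ?_)
  have hp : ∀ A B : Set ℝ, (A ×ˢ B).indicator (fun _ : ℝ × ℝ => (1 : ℝ)) q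
      = A.indicator (fun _ => 1) q.1 * B.indicator (fun _ => 1) q.2 := by
    intro A B
    by_cases h1 : q.1 ∈ A <;> by_cases h2 : q.2 ∈ B <;> simp [Set.indicator, Set.mem_prod, h1, h2]
  simp only [hp, cutSum]
  ring

end

section

variable {μ ν : Measure (ℝ × ℝ)} [IsFiniteMeasure μ] [IsFiniteMeasure ν] {f : ℝ × ℝ → ℝ}

theorem Represents.inversionIntegrand_eq (hr : Represents μ ν f) (hf : MemBVVanishing f)
    (x y : ℝ) {p : ℝ × ℝ} (h1 : p.1 ≠ 0) (h2 : p.2 ≠ 0) :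
    inversionIntegrand f x y p =
      ∫ q, inversionKernel (x - q.1) p.1 * inversionKernel (y - q.2) p.2 ∂μ
      - ∫ q, inversionKernel (x - q.1) p.1 * inversionKernel (y - q.2) p.2 ∂ν := by
  have key : ∀ q : ℝ × ℝ, inversionKernel (x - q.1) p.1 * inversionKernel (y - q.2) p.2 =
      ((Complex.I * p.1) * (Complex.I * p.2))⁻¹ *
        Complex.exp (Complex.I * ((x * p.1 + y * p.2 : ℝ) : ℂ)) *
        (fourierKernel p.1 q.1 * fourierKernel p.2 q.2) := by
    intro q
    rw [inversionKernel, inversionKernel, div_mul_div_comm, ← Complex.exp_add, fourierKernel,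
      fourierKernel, ← Complex.exp_add, mul_assoc (_⁻¹), ← Complex.exp_add, div_eq_mul_inv,
      mul_comm]
    congr 2
    push_cast
    ring
  simp only [key, integral_const_mul]
  rw [inversionIntegrand, (hr.hasKPFourierAt hf h1 h2).kpFourier_eq]
  ring

theorem Represents.inversionIntegrand_ae_eq (hr : Represents μ ν f) (hf : MemBVVanishing f)
    (x y : ℝ) {α₁ α₂ : ℝ} (β₁ β₂ : ℝ) (h1 : 0 < α₁) (h2 : 0 < α₂) :
    inversionIntegrand f x y =ᵐ[volume.restrict (frequencyRegion α₁ α₂ β₁ β₂)] fun p =>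
      ∫ q, inversionKernel (x - q.1) p.1 * inversionKernel (y - q.2) p.2 ∂μ
      - ∫ q, inversionKernel (x - q.1) p.1 * inversionKernel (y - q.2) p.2 ∂ν := by
  filter_upwards [ae_restrict_mem (measurableSet_frequencyRegion α₁ α₂ β₁ β₂)] with p hp
  exact hr.inversionIntegrand_eq hf x y (abs_pos.1 (h1.trans_le hp.1.1))
    (abs_pos.1 (h2.trans_le hp.2.1))

theorem Represents.integrableOn_inversionIntegrand (hr : Represents μ ν f) (hf : MemBVVanishing f)
    (x y : ℝ) {α₁ α₂ : ℝ} (β₁ β₂ : ℝ) (h1 : 0 < α₁) (h2 : 0 < α₂) :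
    IntegrableOn (inversionIntegrand f x y) (frequencyRegion α₁ α₂ β₁ β₂) volume :=
  ((integrable_inversionKernel_mul μ x y h1 h2).integral_prod_left.sub
    (integrable_inversionKernel_mul ν x y h1 h2).integral_prod_left).congr
      (hr.inversionIntegrand_ae_eq hf x y β₁ β₂ h1 h2).symm

theorem Represents.integral_inversionIntegrand (hr : Represents μ ν f) (hf : MemBVVanishing f)
    (x y : ℝ) {α₁ α₂ β₁ β₂ : ℝ} (h1 : 0 < α₁) (h1' : α₁ < β₁) (h2 : 0 < α₂) (h2' : α₂ < β₂) :
    ∫ p in frequencyRegion α₁ α₂ β₁ β₂, inversionIntegrand f x y p =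
      ((∫ q, inversionWeight α₁ β₁ (x - q.1) * inversionWeight α₂ β₂ (y - q.2) ∂μ
        - ∫ q, inversionWeight α₁ β₁ (x - q.1) * inversionWeight α₂ β₂ (y - q.2) ∂ν : ℝ) : ℂ) := by
  rw [integral_congr_ae (hr.inversionIntegrand_ae_eq hf x y β₁ β₂ h1 h2),
    Complex.ofReal_sub, ← integral_inversionKernel_mul μ x y h1 h1' h2 h2',
    ← integral_inversionKernel_mul ν x y h1 h1' h2 h2']
  exact integral_sub (integrable_inversionKernel_mul μ x y h1 h2).integral_prod_left
    (integrable_inversionKernel_mul ν x y h1 h2).integral_prod_left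

/-- By `sign_sub_eq` each sign is `cutSum` minus 1, and equal marginals discard the 1. The four
products of half-lines that remain are exactly the limits supplied by `Represents.tendsto`. -/
theorem Represents.integral_sign_mul_sign (hr : Represents μ ν f) (hf : MemBVVanishing f)
    (x y : ℝ) :
    ∫ q, (Real.pi * SignType.sign (x - q.1)) * (Real.pi * SignType.sign (y - q.2)) ∂μ
      - ∫ q, (Real.pi * SignType.sign (x - q.1)) * (Real.pi * SignType.sign (y - q.2)) ∂ν
    = Real.pi ^ 2 * ((μ.real (Set.Iic x ×ˢ Set.Iic y) - ν.real (Set.Iic x ×ˢ Set.Iic y))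
      + (μ.real (Set.Iic x ×ˢ Set.Iio y) - ν.real (Set.Iic x ×ˢ Set.Iio y))
      + (μ.real (Set.Iio x ×ˢ Set.Iic y) - ν.real (Set.Iio x ×ˢ Set.Iic y))
      + (μ.real (Set.Iio x ×ˢ Set.Iio y) - ν.real (Set.Iio x ×ˢ Set.Iio y))) := by
  have h : ∀ q : ℝ × ℝ, (Real.pi * SignType.sign (x - q.1)) * (Real.pi * SignType.sign (y - q.2))
      = Real.pi ^ 2 * ((cutSum x q.1 - 1) * (cutSum y q.2 - 1)) := by
    intro q
    rw [sign_sub_eq, sign_sub_eq]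
    ring
  simp only [h, integral_const_mul]
  rw [← mul_sub, integral_sub_integral_eq_of_marginals (hr.map_fst_eq hf) (hr.map_snd_eq hf)
    (measurable_cutSum x) (measurable_cutSum y) (norm_cutSum_le x) (norm_cutSum_le y),
    integral_cutSum_mul, integral_cutSum_mul]
  ring

end

theorem eventually_pos_and_lt : ∀ᶠ q : (ℝ × ℝ) × (ℝ × ℝ) in
    (𝓝[>] (0 : ℝ) ×ˢ 𝓝[>] (0 : ℝ)) ×ˢ (atTop ×ˢ atTop),
    (0 < q.1.1 ∧ q.1.1 < q.2.1) ∧ (0 < q.1.2 ∧ q.1.2 < q.2.2) := by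
  have h0 : ∀ᶠ α in 𝓝[>] (0 : ℝ), 0 < α ∧ α < 1 := Ioo_mem_nhdsGT zero_lt_one
  have h1 : ∀ᶠ β in atTop, (1 : ℝ) < β := eventually_gt_atTop 1
  filter_upwards [(h0.prod_mk h0).prod_mk (h1.prod_mk h1)] with q hq
  exact ⟨⟨hq.1.1.1, hq.1.1.2.trans hq.2.1⟩, hq.1.2.1, hq.1.2.2.trans hq.2.2⟩

end KPFourier

open KPFourier
theorem theorem4p1 (f : ℝ × ℝ → ℝ) (hf : MemBVVanishing f) (x y : ℝ) :
    (∀ ξ η : ℝ, ξ ≠ 0 → η ≠ 0 → HasKPFourierAt f ξ η (kpFourier f ξ η)) ∧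
    (∀ α₁ α₂ β₁ β₂ : ℝ, 0 < α₁ → α₁ < β₁ → 0 < α₂ → α₂ < β₂ →
      IntegrableOn (inversionIntegrand f x y) (frequencyRegion α₁ α₂ β₁ β₂) volume) ∧
    ∃ Lpp Lpm Lmp Lmm : ℝ,
      Tendsto f (𝓝[>] x ×ˢ 𝓝[>] y) (𝓝 Lpp) ∧
      Tendsto f (𝓝[>] x ×ˢ 𝓝[<] y) (𝓝 Lpm) ∧
      Tendsto f (𝓝[<] x ×ˢ 𝓝[>] y) (𝓝 Lmp) ∧
      Tendsto f (𝓝[<] x ×ˢ 𝓝[<] y) (𝓝 Lmm) ∧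
      Tendsto
        (fun q : (ℝ × ℝ) × (ℝ × ℝ) =>
          (1 / (4 * (Real.pi : ℂ) ^ 2)) *
            ∫ p in frequencyRegion q.1.1 q.1.2 q.2.1 q.2.2, inversionIntegrand f x y p)
        ((𝓝[>] (0 : ℝ) ×ˢ 𝓝[>] (0 : ℝ)) ×ˢ (atTop ×ˢ atTop))
        (𝓝 (((Lpp + Lpm + Lmp + Lmm) / 4 : ℝ) : ℂ)) := by
  obtain ⟨μ, ν, hμ, hν, hr⟩ := hf.exists_measures
  have hr : Represents μ ν f := ⟨fun s t => (hr s t).1, fun s t => (hr s t).2⟩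
  refine ⟨fun ξ η hξ hη => ?_, fun α₁ α₂ β₁ β₂ h1 _ h2 _ =>
    hr.integrableOn_inversionIntegrand hf x y β₁ β₂ h1 h2, _, _, _, _,
    hr.tendsto measurableSet_Iic measurableSet_Iic (cutTendsto_nhdsGT x) (cutTendsto_nhdsGT y),
    hr.tendsto measurableSet_Iic measurableSet_Iio (cutTendsto_nhdsGT x) (cutTendsto_nhdsLT y),
    hr.tendsto measurableSet_Iio measurableSet_Iic (cutTendsto_nhdsLT x) (cutTendsto_nhdsGT y),
    hr.tendsto measurableSet_Iio measurableSet_Iio (cutTendsto_nhdsLT x) (cutTendsto_nhdsLT y), ?_⟩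
  · have h := hr.hasKPFourierAt hf hξ hη
    rwa [h.kpFourier_eq]
  · have h1 := (tendsto_integral_inversionWeight μ x y).sub
      (tendsto_integral_inversionWeight ν x y)
    rw [hr.integral_sign_mul_sign hf] at h1
    have h2 := ((Complex.continuous_ofReal.tendsto _).comp h1).const_mul
      (1 / (4 * (Real.pi : ℂ) ^ 2))
    have hpi : (Real.pi : ℂ) ≠ 0 := by exact_mod_cast Real.pi_ne_zero
    refine Tendsto.congr' ?_ (h2.trans (le_of_eq (congrArg 𝓝 ?_)))
    · filter_upwards [eventually_pos_and_lt] with q hq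
      rw [hr.integral_inversionIntegrand hf x y hq.1.1 hq.1.2 hq.2.1 hq.2.2]
      rfl
    · push_cast
      field_simp
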